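/- Let $\mathbb F_q$ be a finite field and let $K,N,T,B\ge 0$ be integers with $K\ge 2$ and $N>2B+T$. A database consists of $K$ independent files $W_1,\dots,W_K$, each uniformly distributed on $\mathbb F_q^L$ (where $L\ge 1$ is chosen by the scheme), and is replicated at $N$ servers. All random variables take finitely many values, and $H$, $I$ denote Shannon entropy and mutual information. The user has private randomness $U$, the servers share common randomness $S$ unavailable to the user, the desired index $\kappa$ is uniform on $\{1,\dots,K\}$, and $\kappa, U, (W_1,\dots,W_K), S$ are independent. A scheme specifies queries $Q_n^{[k]}$ that are functions of $k$ and $U$, randomness $S_n$ that is a function of $S$, authentic answers $A_n^{[k]}$ that are functions of $Q_n^{[k]}$, $W_1,\dots,W_K$ and $S_n$, and a decoder, which is given $k$, the collection $\mathcal Q=(Q_n^{[k']})_{n,k'}$ of all queries, and the $N$ received answers. It is a T-BSPIR scheme if 1. (zero error) for every $k$, every realization of positive probability, and every replacement of the answers of at most $B$ servers by arbitrary values of the answer alphabets, the decoder outputs $W_k$; 2. (user-privacy) $I\big(\kappa;\,(Q_n^{[\kappa]},A_n^{[\kappa]})_{n\in\mathcal T},W_1,\dots,W_K,S\big)=0$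 for every set $\mathcal T$ of $T$ servers; 3. (database-privacy) if $W_{\bar\kappa}$ is the tuple of the $K-1$ files other than $W_\kappa$ (in increasing order of index) and $\tilde A_1,\dots,\tilde A_N$ are the received answers, then $I(W_{\bar\kappa};\tilde A_1,\dots,\tilde A_N,\mathcal Q,\kappa)=0$, both when all answers are authentic and when an adversary who sees all transmissions (the queries $Q_n^{[\kappa]}$ and answers $A_n^{[\kappa]}$) overwrites those of a set of at most $B$ servers as a function of what it sees. For $k\in\{1,\dots,K\}$, the rate of a scheme is $R=H(W_k)/\sum_{n=1}^N H(A_n^{[k]})$ and its secrecy rate is $\rho=H(S)/H(W_k)$. The capacity $C(\rho)$ at secrecy rate $\rho\in\mathbb R$ is the supremum of the rates of all T-BSPIR schemes with secrecy rate $\rho$ (and $0$ if there is none). Then, for every $k$ and every $\rho$, $$C(\rho)=\begin{cases}1-\dfrac{2B+T}{N}, & \text{if }\rho\ge \dfrac{T}{N-2B-T},\\[2mm] 0, & \text{otherwise.}\end{cases}$$ -/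

import Mathlib

open scoped ENNReal

noncomputable section

namespace SPIR

/-! ### Entropy on a finite probability space (natural logarithm) -/

/-- The probability that `X = x`, for the probability mass function `p`. -/
def prob {Ω α : Type*} [Fintype Ω] (p : Ω → ℝ) (X : Ω → α) (x : α) : ℝ :=
  ∑ ω, Set.indicator {ω | X ω = x} p ω

/-- Shannon entropy `H(X)` of the random variable `X`, for the probability mass function `p`. -/
def entropy {Ω α : Type*} [Fintype Ω] (p : Ω → ℝ) (X : Ω → α) : ℝ :=
  ∑ x ∈ (Set.finite_range X).toFinset, Real.negMulLog (prob p X x)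

/-- Mutual information `I(X ; Y) = H(X) + H(Y) - H(X, Y)`. -/
def mutualInfo {Ω α β : Type*} [Fintype Ω] (p : Ω → ℝ) (X : Ω → α) (Y : Ω → β) : ℝ :=
  entropy p X + entropy p Y - entropy p (fun ω => (X ω, Y ω))

/-! ### Retrieval protocols -/

/-- A one-round protocol for retrieving one of `K` files, each a word of `fileLength ≥ 1` symbols
of `F`, from `N` servers that all store the `K` files. No privacy or correctness is required yet. -/
structure Protocol (F : Type) (K N : ℕ) where
  /-- Number of symbols of each file. -/
  fileLength : ℕ
  fileLength_pos : 0 < fileLength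
  /-- Alphabet of the private randomness of the user, and its distribution. -/
  UserRand : Type
  [fintypeUserRand : Fintype UserRand]
  userProb : UserRand → ℝ
  userProb_mem : userProb ∈ stdSimplex ℝ UserRand
  /-- Alphabet of the common randomness of the servers, and its distribution. -/
  CommonRand : Type
  [fintypeCommonRand : Fintype CommonRand]
  commonProb : CommonRand → ℝ
  commonProb_mem : commonProb ∈ stdSimplex ℝ CommonRand
  /-- Alphabets of the queries, of the randomness used by each server, and of the answers. -/
  Query : Fin N → Type
  NodeRand : Fin N → Type
  Answer : Fin N → Type
  /-- The query sent to server `n` when file `k` is desired. -/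
  query : (n : Fin N) → Fin K → UserRand → Query n
  /-- The part of the common randomness used by server `n`. -/
  nodeRand : (n : Fin N) → CommonRand → NodeRand n
  /-- The answer of server `n`, from its query, the database and its randomness. -/
  answer : (n : Fin N) → Query n → (Fin K → Fin fileLength → F) → NodeRand n → Answer n
  /-- The decoder of the user, from the desired index, the complete collection of queries (for all
  possible desired indices), and the received answers. -/
  decode : Fin K → ((n : Fin N) → Fin K → Query n) → ((n : Fin N) → Answer n) →
    (Fin fileLength → F)

attribute [instance] Protocol.fintypeUserRand Protocol.fintypeCommonRand

namespace Protocol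

variable {F : Type} {K N : ℕ} (P : Protocol F K N)

/-- A file. -/
abbrev File : Type := Fin P.fileLength → F

/-- A database: `K` files. -/
abbrev Database : Type := Fin K → P.File

/-- The sample space: desired index, randomness of the user, database, common randomness. -/
abbrev Sample : Type := Fin K × P.UserRand × P.Database × P.CommonRand

/-- The desired index `κ`. -/
def index (ω : P.Sample) : Fin K := ω.1

/-- The private randomness `U` of the user. -/
def userRand (ω : P.Sample) : P.UserRand := ω.2.1

/-- The database `W_1, …, W_K`. -/
def files (ω : P.Sample) : P.Database := ω.2.2.1

/-- The common randomness `S`. -/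
def commonRand (ω : P.Sample) : P.CommonRand := ω.2.2.2

/-- The joint distribution: the four components are independent, the desired index is uniform, and
the files are independent and uniform. -/
def law [Fintype F] (ω : P.Sample) : ℝ :=
  (K : ℝ)⁻¹ * P.userProb (P.userRand ω) * (Fintype.card P.Database : ℝ)⁻¹ *
    P.commonProb (P.commonRand ω)

/-- The query `Q_n^{[k]}`. -/
def queryVar (n : Fin N) (k : Fin K) (ω : P.Sample) : P.Query n :=
  P.query n k (P.userRand ω)

/-- The collection `𝒬` of all the queries `Q_n^{[k]}`. -/
def allQueries (ω : P.Sample) : (n : Fin N) → Fin K → P.Query n :=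
  fun n k => P.queryVar n k ω

/-- The authentic answer `A_n^{[k]}`. -/
def answerVar (n : Fin N) (k : Fin K) (ω : P.Sample) : P.Answer n :=
  P.answer n (P.queryVar n k ω) (P.files ω) (P.nodeRand n (P.commonRand ω))

/-- The `K - 1` files other than the desired one, in increasing order of their indices. -/
def otherFiles (ω : P.Sample) : Fin (K - 1) → P.File :=
  fun j => P.files ω
    ((Finset.univ.erase (P.index ω)).orderEmbOfFin
      (by rw [Finset.card_erase_of_mem (Finset.mem_univ _), Finset.card_fin]) j)

/-- Zero-error decoding: on every realization of positive probability, whatever the desired index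
and whatever answers replace those of at most `B` servers, the user decodes the desired file. -/
def ZeroError [Fintype F] (B : ℕ) : Prop :=
  ∀ (k : Fin K) (ω : P.Sample), P.law ω ≠ 0 →
    ∀ 𝓑 : Finset (Fin N), 𝓑.card ≤ B →
      ∀ y : (n : Fin N) → P.Answer n, (∀ n ∉ 𝓑, y n = P.answerVar n k ω) →
        P.decode k (P.allQueries ω) y = P.files ω k

/-- User-privacy: `I(κ ; Q_𝒯^{[κ]}, A_𝒯^{[κ]}, W_1, …, W_K, S) = 0` for every set `𝒯` of `T`
servers. -/
def UserPrivacy [Fintype F] (T : ℕ) : Prop :=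
  ∀ 𝒯 : Finset (Fin N), 𝒯.card = T →
    mutualInfo P.law P.index (fun ω =>
      ((fun n : 𝒯 => P.queryVar n (P.index ω) ω), (fun n : 𝒯 => P.answerVar n (P.index ω) ω),
        P.files ω, P.commonRand ω)) = 0

/-- Database-privacy: the received answers, the collection of all queries and the desired index
are independent of the other files. The received answers are the authentic ones, except that an
adversary who observes all transmissions (queries and answers) may have overwritten those of a set
of at most `B` servers; `tamper` is its strategy, and the identity is one of its choices. -/
def DatabasePrivacy [Fintype F] (B : ℕ) : Prop :=
  ∀ 𝓑 : Finset (Fin N), 𝓑.card ≤ B →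
    ∀ tamper : ((n : Fin N) → P.Query n) → ((n : Fin N) → P.Answer n) →
        (n : Fin N) → P.Answer n,
      (∀ q a, ∀ n ∉ 𝓑, tamper q a n = a n) →
        mutualInfo P.law P.otherFiles (fun ω =>
          (tamper (fun n => P.queryVar n (P.index ω) ω) (fun n => P.answerVar n (P.index ω) ω),
            P.allQueries ω, P.index ω)) = 0

/-- The protocol solves symmetric private information retrieval with `T` colluding servers and a
Byzantine adversary who overwrites the answers of at most `B` servers. -/
structure IsTBSPIR [Fintype F] (T B : ℕ) : Prop where
  zeroError : P.ZeroError B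
  userPrivacy : P.UserPrivacy T
  databasePrivacy : P.DatabasePrivacy B

/-- The entropy `H(W_k)`. -/
def fileEntropy [Fintype F] (k : Fin K) : ℝ := entropy P.law (fun ω => P.files ω k)

/-- The rate `H(W_k) / ∑ n, H(A_n^{[k]})`; it is infinite if the denominator vanishes. -/
def rate [Fintype F] (k : Fin K) : ℝ≥0∞ :=
  ENNReal.ofReal (P.fileEntropy k) / ENNReal.ofReal (∑ n, entropy P.law (P.answerVar n k))

/-- The secrecy rate `H(S) / H(W_k)`. -/
def secrecyRate [Fintype F] (k : Fin K) : ℝ := entropy P.law P.commonRand / P.fileEntropy k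

end Protocol

/-- The capacity at secrecy rate `ρ`: the supremum of the rates of all schemes whose secrecy rate
is `ρ`. Every scheme has positive rate, and the supremum of no rates is `0`. -/
def capacity (F : Type) [Fintype F] (K N T B : ℕ) (ρ : ℝ) (k : Fin K) : ℝ≥0∞ :=
  ⨆ (P : Protocol F K N) (_ : P.IsTBSPIR T B) (_ : P.secrecyRate k = ρ), P.rate k

end SPIR

end

noncomputable section

namespace SPIR

/-! Put `M = N - 2B - T` and let `h` be the entropy of a file.

Converse. Fix a realization `u` of the user's randomness of positive probability; only the database
and `S` stay random (`serverLaw`). Zero error makes any `N - 2B` answers determine `W_k`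
(`files_eq_of_answerAt_eq`). User-privacy makes the queries to a set `t` of `T` servers possible for
another desired index as well, and database-privacy for that index makes the answers of `t`
independent of `W_k` (`exists_query_eq`, `mutualInfo_otherFiles_answerAt`). Hence `h + H(A_t) ≤
H(A_s)` whenever `t ⊆ s` and `s` has at least `N - 2B` elements
(`fileEntropy_add_answerEntropy_le`). Everything else follows from this inequality and
submodularity. For the rate, take `s = t ∪ d` with `M` servers in `d`: then `h ≤ ∑_{n ∈ d} H(A_n)`,
and averaging over `u` and `d` gives `N h ≤ M ∑ H(A_n)` (`rate_le`). For the secrecy rate, a greedy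
choice finds `T` servers with `H(A_t) ≥ T h / M` (`exists_le_answerEntropy`), while counting the
entropy of files and `S` gives `H(A_t) ≤ H(S)` (`answerEntropy_le_entropy_commonRand`).

Achievability. Over an extension `E` of `F` with at least `N` elements, the queries are Shamir
shares of the selection vectors, placed so that the answers are the values of one polynomial of
degree below `T + M`: its top `M` coefficients are the desired file, and its lower `T` are masked by
uniform common randomness. Reed-Solomon decoding corrects `B` errors since `T + M + 2B = N`. The two
privacy conditions hold because symmetries of the law move the secret and fix the view
(`mutualInfo_eq_zero_of_symmetry`). Padding `S` with an unused independent variable reaches every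
larger secrecy rate. -/

open Classical in
theorem prob_eq_sum_ite {Ω α : Type*} [Fintype Ω] (p : Ω → ℝ) (X : Ω → α) (x : α) :
    prob p X x = ∑ ω, if X ω = x then p ω else 0 := by
  simp [prob, Set.indicator]

/-! ### Elementary properties of probability and entropy. -/

section Basic

variable {Ω α β γ : Type*} [Fintype Ω] {p : Ω → ℝ}

theorem prob_nonneg (hp : ∀ ω, 0 ≤ p ω) (X : Ω → α) (x : α) : 0 ≤ prob p X x :=
  Finset.sum_nonneg fun ω _ => Set.indicator_nonneg (fun ω _ => hp ω) ω

theorem le_prob (hp : ∀ ω, 0 ≤ p ω) (X : Ω → α) (ω : Ω) : p ω ≤ prob p X (X ω) := by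
  classical
  rw [prob_eq_sum_ite]
  have := Finset.single_le_sum (f := fun ω' => if X ω' = X ω then p ω' else 0)
    (fun ω' _ => by split_ifs <;> simp [hp]) (Finset.mem_univ ω)
  simpa using this

theorem prob_pos (hp : ∀ ω, 0 ≤ p ω) (X : Ω → α) {ω : Ω} (h : p ω ≠ 0) : 0 < prob p X (X ω) :=
  lt_of_lt_of_le (lt_of_le_of_ne (hp ω) h.symm) (le_prob hp X ω)

theorem exists_of_prob_ne_zero {X : Ω → α} {x : α} (h : prob p X x ≠ 0) :
    ∃ ω, p ω ≠ 0 ∧ X ω = x := by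
  classical
  rw [prob_eq_sum_ite] at h
  obtain ⟨ω, -, hω⟩ := Finset.exists_ne_zero_of_sum_ne_zero h
  by_cases hx : X ω = x
  · exact ⟨ω, by simpa [hx] using hω, hx⟩
  · simp [hx] at hω

theorem prob_le_one (hp : p ∈ stdSimplex ℝ Ω) (X : Ω → α) (x : α) : prob p X x ≤ 1 := by
  classical
  rw [prob_eq_sum_ite, ← hp.2]
  refine Finset.sum_le_sum fun ω _ => ?_
  split_ifs
  · rfl
  · exact hp.1 ω

theorem prob_congr_of_support {X : Ω → α} {Y : Ω → β} {x : α} {y : β}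
    (h : ∀ ω, p ω ≠ 0 → (X ω = x ↔ Y ω = y)) : prob p X x = prob p Y y := by
  classical
  rw [prob_eq_sum_ite, prob_eq_sum_ite]
  refine Finset.sum_congr rfl fun ω _ => ?_
  by_cases hω : p ω = 0
  · simp [hω]
  · simp [h ω hω]

theorem entropy_eq_sum (p : Ω → ℝ) (X : Ω → α) :
    entropy p X = ∑ ω, p ω * (-Real.log (prob p X (X ω))) := by
  classical
  unfold entropy
  have h : ∀ x, Real.negMulLog (prob p X x)
      = ∑ ω, if X ω = x then p ω * (-Real.log (prob p X (X ω))) else 0 := by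
    intro x
    rw [Real.negMulLog, neg_mul, ← mul_neg]
    conv_lhs => rw [prob_eq_sum_ite, Finset.sum_mul]
    refine Finset.sum_congr rfl fun ω _ => ?_
    split_ifs with hx
    · rw [← hx, ← prob_eq_sum_ite]
    · simp
  simp_rw [h]
  rw [Finset.sum_comm]
  refine Finset.sum_congr rfl fun ω _ => ?_
  rw [Finset.sum_ite_eq, if_pos (by simp)]

theorem entropy_le_of_determines (hp : ∀ ω, 0 ≤ p ω) {X : Ω → α} {Y : Ω → β}
    (h : ∀ ω ω', p ω ≠ 0 → p ω' ≠ 0 → Y ω = Y ω' → X ω = X ω') : entropy p X ≤ entropy p Y := by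
  classical
  rw [entropy_eq_sum, entropy_eq_sum]
  refine Finset.sum_le_sum fun ω _ => ?_
  by_cases hω : p ω = 0
  · simp [hω]
  refine mul_le_mul_of_nonneg_left (neg_le_neg (Real.log_le_log (prob_pos hp Y hω) ?_)) (hp ω)
  rw [prob_eq_sum_ite, prob_eq_sum_ite]
  refine Finset.sum_le_sum fun ω' _ => ?_
  by_cases hω' : p ω' = 0
  · simp [hω']
  by_cases hy : Y ω' = Y ω
  · simp [hy, h ω' ω hω' hω hy]
  · simp only [hy, if_false]
    split_ifs <;> simp [hp]

theorem entropy_nonneg (hp : p ∈ stdSimplex ℝ Ω) (X : Ω → α) : 0 ≤ entropy p X := by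
  rw [entropy_eq_sum]
  refine Finset.sum_nonneg fun ω _ => mul_nonneg (hp.1 ω) ?_
  exact neg_nonneg.2 (Real.log_nonpos (prob_nonneg hp.1 _ _) (prob_le_one hp _ _))

theorem entropy_const (hp : p ∈ stdSimplex ℝ Ω) (c : α) : entropy p (fun _ => c) = 0 := by
  have : prob p (fun _ => c) c = 1 := by simp [prob, hp.2]
  simp [entropy_eq_sum, this]

end Basic

/-! ### Conditional mutual information, submodularity, independence and uniformity from symmetry. -/

section Conditional

variable {Ω α β γ : Type*} [Fintype Ω] {p : Ω → ℝ} (X : Ω → α) (Y : Ω → β) (Z : Ω → γ)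

open Classical in
/-- The weight of a pair of realizations in the coupling under which `(X, Z)` and `(Y, Z)` have
their own laws, and `X`, `Y` are conditionally independent given `Z`. -/
def condWeight (p : Ω → ℝ) (ω ω' : Ω) : ℝ :=
  if Z ω' = Z ω then p ω * p ω' / prob p Z (Z ω) else 0

/-- The density of the law of `(X, Y, Z)` with respect to the conditionally independent law. -/
def condRatio (p : Ω → ℝ) (ω ω' : Ω) : ℝ :=
  prob p (fun ω => (X ω, Y ω, Z ω)) (X ω, Y ω', Z ω) * prob p Z (Z ω) /
    (prob p (fun ω => (X ω, Z ω)) (X ω, Z ω) * prob p (fun ω => (Y ω, Z ω)) (Y ω', Z ω))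

theorem condWeight_nonneg (hp : ∀ ω, 0 ≤ p ω) (ω ω' : Ω) : 0 ≤ condWeight Z p ω ω' := by
  unfold condWeight
  split_ifs
  · exact div_nonneg (mul_nonneg (hp _) (hp _)) (prob_nonneg hp _ _)
  · rfl

theorem condRatio_nonneg (hp : ∀ ω, 0 ≤ p ω) (ω ω' : Ω) : 0 ≤ condRatio X Y Z p ω ω' :=
  div_nonneg (mul_nonneg (prob_nonneg hp _ _) (prob_nonneg hp _ _))
    (mul_nonneg (prob_nonneg hp _ _) (prob_nonneg hp _ _))

theorem sum_condWeight (hp : p ∈ stdSimplex ℝ Ω) : ∑ ω, ∑ ω', condWeight Z p ω ω' = 1 := by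
  classical
  rw [← hp.2]
  refine Finset.sum_congr rfl fun ω _ => ?_
  by_cases hω : p ω = 0
  · simp [condWeight, hω]
  have h : ∀ ω', condWeight Z p ω ω'
      = p ω / prob p Z (Z ω) * (if Z ω' = Z ω then p ω' else 0) := by
    intro ω'
    unfold condWeight
    split_ifs <;> ring
  simp_rw [h]
  rw [← Finset.mul_sum, ← prob_eq_sum_ite, div_mul_cancel₀ _ (prob_pos hp.1 Z hω).ne']

/-- Change of measure from the coupling to the true joint law: expanding the joint probability in
`condRatio` as a sum over `ω₀` leaves, for each `ω₀`, two sums that cancel the two denominators. -/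
theorem sum_condWeight_mul_condRatio_mul (hp : p ∈ stdSimplex ℝ Ω) (f : α → β → γ → ℝ) :
    ∑ ω, ∑ ω', condWeight Z p ω ω' * condRatio X Y Z p ω ω' * f (X ω) (Y ω') (Z ω)
      = ∑ ω, p ω * f (X ω) (Y ω) (Z ω) := by
  classical
  set PX := prob p (fun ω => (X ω, Z ω)) with hPX
  set PY := prob p (fun ω => (Y ω, Z ω)) with hPY
  have h : ∀ ω ω', condWeight Z p ω ω' * condRatio X Y Z p ω ω' * f (X ω) (Y ω') (Z ω)
      = ∑ ω₀, p ω₀ * f (X ω₀) (Y ω₀) (Z ω₀) *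
        (((if (X ω, Z ω) = (X ω₀, Z ω₀) then p ω else 0) / PX (X ω₀, Z ω₀)) *
        ((if (Y ω', Z ω') = (Y ω₀, Z ω₀) then p ω' else 0) / PY (Y ω₀, Z ω₀))) := by
    intro ω ω'
    by_cases hω : p ω = 0
    · simp [hω, condWeight]
    unfold condWeight condRatio
    by_cases hz : Z ω' = Z ω
    · rw [if_pos hz]
      have hz0 := (prob_pos hp.1 Z hω).ne'
      have : p ω * p ω' / prob p Z (Z ω) *
          (prob p (fun ω => (X ω, Y ω, Z ω)) (X ω, Y ω', Z ω) * prob p Z (Z ω) /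
          (PX (X ω, Z ω) * PY (Y ω', Z ω))) * f (X ω) (Y ω') (Z ω) =
          prob p (fun ω => (X ω, Y ω, Z ω)) (X ω, Y ω', Z ω) * (p ω * p ω' /
          (PX (X ω, Z ω) * PY (Y ω', Z ω)) * f (X ω) (Y ω') (Z ω)) := by
        field_simp
      rw [this, prob_eq_sum_ite, Finset.sum_mul]
      refine Finset.sum_congr rfl fun ω₀ _ => ?_
      by_cases hc : (X ω₀, Y ω₀, Z ω₀) = (X ω, Y ω', Z ω)
      · simp only [Prod.mk.injEq] at hc
        obtain ⟨h1, h2, h3⟩ := hc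
        simp only [h1, h2, h3, hz, if_true]
        ring
      · rw [if_neg hc, zero_mul]
        by_cases h1 : (X ω, Z ω) = (X ω₀, Z ω₀)
        · by_cases h2 : (Y ω', Z ω') = (Y ω₀, Z ω₀)
          · exfalso
            simp only [Prod.mk.injEq] at h1 h2 hc
            exact hc ⟨h1.1.symm, h2.1.symm, h1.2.symm⟩
          · rw [if_neg h2]; simp
        · rw [if_neg h1]; simp
    · rw [if_neg hz, zero_mul, zero_mul]
      symm
      refine Finset.sum_eq_zero fun ω₀ _ => ?_
      by_cases h1 : (X ω, Z ω) = (X ω₀, Z ω₀)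
      · by_cases h2 : (Y ω', Z ω') = (Y ω₀, Z ω₀)
        · exfalso
          simp only [Prod.mk.injEq] at h1 h2
          exact hz (h2.2.trans h1.2.symm)
        · rw [if_neg h2]; simp
      · rw [if_neg h1]; simp
  simp_rw [h]
  rw [Finset.sum_congr rfl fun ω _ => Finset.sum_comm, Finset.sum_comm]
  refine Finset.sum_congr rfl fun ω₀ _ => ?_
  by_cases hω : p ω₀ = 0
  · simp [hω]
  simp_rw [← Finset.mul_sum]
  have hPX' : ∀ x, (∑ ω, if (X ω, Z ω) = x then p ω else 0) = PX x := fun x => by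
    rw [hPX, prob_eq_sum_ite]
    exact Finset.sum_congr rfl fun _ _ => by congr
  have hPY' : ∀ y, (∑ ω, if (Y ω, Z ω) = y then p ω else 0) = PY y := fun y => by
    rw [hPY, prob_eq_sum_ite]
    exact Finset.sum_congr rfl fun _ _ => by congr
  rw [← Finset.sum_mul, ← Finset.sum_div, ← Finset.sum_div, hPX', hPY', div_self (prob_pos hp.1 (fun ω => (X ω, Z ω)) hω).ne',
    div_self (prob_pos hp.1 (fun ω => (Y ω, Z ω)) hω).ne']
  ring

/-- Conditional mutual information as a Kullback-Leibler divergence. -/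
theorem entropy_sub_eq_sum_klFun (hp : p ∈ stdSimplex ℝ Ω) :
    entropy p (fun ω => (X ω, Z ω)) + entropy p (fun ω => (Y ω, Z ω))
      - entropy p (fun ω => (X ω, Y ω, Z ω)) - entropy p Z
    = ∑ ω, ∑ ω', condWeight Z p ω ω' * InformationTheory.klFun (condRatio X Y Z p ω ω') := by
  have h1 := sum_condWeight_mul_condRatio_mul X Y Z hp (fun _ _ _ => 1)
  have h2 := sum_condWeight_mul_condRatio_mul X Y Z hp (fun x y z => Real.log
    (prob p (fun ω => (X ω, Y ω, Z ω)) (x, y, z) * prob p Z z /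
    (prob p (fun ω => (X ω, Z ω)) (x, z) * prob p (fun ω => (Y ω, Z ω)) (y, z))))
  have h3 := sum_condWeight Z hp
  simp only [mul_one, hp.2] at h1
  have h4 : ∑ ω, ∑ ω', condWeight Z p ω ω' * InformationTheory.klFun (condRatio X Y Z p ω ω')
      = ∑ ω, ∑ ω', condWeight Z p ω ω' * condRatio X Y Z p ω ω' *
          Real.log (condRatio X Y Z p ω ω')
        + ∑ ω, ∑ ω', condWeight Z p ω ω'
        - ∑ ω, ∑ ω', condWeight Z p ω ω' * condRatio X Y Z p ω ω' := by
    simp only [← Finset.sum_add_distrib, ← Finset.sum_sub_distrib]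
    refine Finset.sum_congr rfl fun ω _ => Finset.sum_congr rfl fun ω' _ => ?_
    rw [InformationTheory.klFun]
    ring
  rw [h4, h3, h1, add_sub_cancel_right]
  refine Eq.trans ?_ h2.symm
  simp only [entropy_eq_sum, ← Finset.sum_add_distrib, ← Finset.sum_sub_distrib]
  refine Finset.sum_congr rfl fun ω _ => ?_
  by_cases hω : p ω = 0
  · simp [hω]
  have e1 := (prob_pos hp.1 (fun ω => (X ω, Z ω)) hω).ne'
  have e2 := (prob_pos hp.1 (fun ω => (Y ω, Z ω)) hω).ne'
  have e3 := (prob_pos hp.1 (fun ω => (X ω, Y ω, Z ω)) hω).ne'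
  have e4 := (prob_pos hp.1 Z hω).ne'
  rw [Real.log_div (mul_ne_zero e3 e4) (mul_ne_zero e1 e2), Real.log_mul e3 e4,
    Real.log_mul e1 e2]
  ring

theorem entropy_submodular (hp : p ∈ stdSimplex ℝ Ω) :
    entropy p (fun ω => (X ω, Y ω, Z ω)) + entropy p Z
      ≤ entropy p (fun ω => (X ω, Z ω)) + entropy p (fun ω => (Y ω, Z ω)) := by
  have h := entropy_sub_eq_sum_klFun X Y Z hp
  have : 0 ≤ ∑ ω, ∑ ω', condWeight Z p ω ω' *
      InformationTheory.klFun (condRatio X Y Z p ω ω') :=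
    Finset.sum_nonneg fun ω _ => Finset.sum_nonneg fun ω' _ =>
      mul_nonneg (condWeight_nonneg Z hp.1 _ _)
        (InformationTheory.klFun_nonneg (condRatio_nonneg X Y Z hp.1 _ _))
  linarith

theorem entropy_congr (hp : ∀ ω, 0 ≤ p ω) {X : Ω → α} {Y : Ω → β}
    (h : ∀ ω ω', p ω ≠ 0 → p ω' ≠ 0 → (X ω = X ω' ↔ Y ω = Y ω')) : entropy p X = entropy p Y :=
  le_antisymm (entropy_le_of_determines hp fun ω ω' h1 h2 => (h ω ω' h1 h2).2)
    (entropy_le_of_determines hp fun ω ω' h1 h2 => (h ω ω' h1 h2).1)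

theorem entropy_pair_le (hp : p ∈ stdSimplex ℝ Ω) :
    entropy p (fun ω => (X ω, Y ω)) ≤ entropy p X + entropy p Y := by
  have h := entropy_submodular X Y (fun _ => ()) hp
  have h0 := entropy_const hp ()
  rw [entropy_congr hp.1 (X := fun ω => (X ω, Y ω, ())) (Y := fun ω => (X ω, Y ω)) (by simp),
    entropy_congr hp.1 (X := fun ω => (X ω, ())) (Y := X) (by simp),
    entropy_congr hp.1 (X := fun ω => (Y ω, ())) (Y := Y) (by simp)] at h
  linarith

variable {X Y}

/-- With trivial `Z` the mutual information is a sum of nonnegative terms, so each term vanishes,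
and `klFun` vanishes only where the density ratio is 1. -/
theorem prob_mul_prob_of_mutualInfo_eq_zero (hp : p ∈ stdSimplex ℝ Ω)
    (h : mutualInfo p X Y = 0) (x : α) (y : β) :
    prob p (fun ω => (X ω, Y ω)) (x, y) = prob p X x * prob p Y y := by
  have key := entropy_sub_eq_sum_klFun X Y (fun _ => ()) hp
  have h0 := entropy_const hp ()
  rw [entropy_congr hp.1 (X := fun ω => (X ω, Y ω, ())) (Y := fun ω => (X ω, Y ω)) (by simp),
    entropy_congr hp.1 (X := fun ω => (X ω, ())) (Y := X) (by simp),
    entropy_congr hp.1 (X := fun ω => (Y ω, ())) (Y := Y) (by simp), h0, sub_zero] at key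
  replace key := h.symm.trans key
  have hnn : ∀ ω ω', 0 ≤ condWeight (fun _ => ()) p ω ω' *
      InformationTheory.klFun (condRatio X Y (fun _ => ()) p ω ω') := fun ω ω' =>
    mul_nonneg (condWeight_nonneg _ hp.1 _ _)
        (InformationTheory.klFun_nonneg (condRatio_nonneg X Y _ hp.1 _ _))
  have hu : prob p (fun _ => ()) () = 1 := by simp [prob, hp.2]
  -- Values of probability zero are not represented by any pair of positive weight, so they are
  -- treated apart.
  by_cases hx : prob p X x = 0
  · rw [hx, zero_mul]
    by_contra hne
    obtain ⟨ω, hω, he⟩ := exists_of_prob_ne_zero hne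
    simp only [Prod.mk.injEq] at he
    have := prob_pos hp.1 X hω
    rw [he.1, hx] at this
    exact lt_irrefl _ this
  by_cases hy : prob p Y y = 0
  · rw [hy, mul_zero]
    by_contra hne
    obtain ⟨ω, hω, he⟩ := exists_of_prob_ne_zero hne
    simp only [Prod.mk.injEq] at he
    have := prob_pos hp.1 Y hω
    rw [he.2, hy] at this
    exact lt_irrefl _ this
  obtain ⟨ω, hω, rfl⟩ := exists_of_prob_ne_zero hx
  obtain ⟨ω', hω', rfl⟩ := exists_of_prob_ne_zero hy
  have h1 := (Finset.sum_eq_zero_iff_of_nonneg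
    fun ω _ => Finset.sum_nonneg fun ω' _ => hnn ω ω').1 key.symm ω (Finset.mem_univ _)
  have h2 := (Finset.sum_eq_zero_iff_of_nonneg fun ω' _ => hnn ω ω').1 h1 ω' (Finset.mem_univ _)
  have hw : condWeight (fun _ => ()) p ω ω' ≠ 0 := by
    simp [condWeight, hu, hω, hω']
  have h3 := (InformationTheory.klFun_eq_zero_iff (condRatio_nonneg X Y _ hp.1 _ _)).1
    ((mul_eq_zero.1 h2).resolve_left hw)
  unfold condRatio at h3
  rw [hu, mul_one,
    prob_congr_of_support (X := fun ω => (X ω, Y ω, ())) (Y := fun ω => (X ω, Y ω))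
      (y := (X ω, Y ω')) (by simp),
    prob_congr_of_support (X := fun ω => (X ω, ())) (Y := X) (y := X ω) (by simp),
    prob_congr_of_support (X := fun ω => (Y ω, ())) (Y := Y) (y := Y ω') (by simp)] at h3
  exact eq_of_div_eq_one h3

theorem sum_prob_pair (p : Ω → ℝ) (X : Ω → α) (Y : Ω → β) (x : α) :
    ∑ y ∈ (Set.finite_range Y).toFinset, prob p (fun ω => (X ω, Y ω)) (x, y) = prob p X x := by
  classical
  simp_rw [prob_eq_sum_ite]
  rw [Finset.sum_comm]
  refine Finset.sum_congr rfl fun ω _ => ?_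
  simp only [Prod.mk.injEq, ite_and]
  split_ifs
  · rw [Finset.sum_ite_eq, if_pos (by simp)]
  · simp

theorem sum_prob (p : Ω → ℝ) (X : Ω → α) :
    ∑ x ∈ (Set.finite_range X).toFinset, prob p X x = ∑ ω, p ω := by
  classical
  simp_rw [prob_eq_sum_ite]
  rw [Finset.sum_comm]
  refine Finset.sum_congr rfl fun ω _ => ?_
  rw [Finset.sum_ite_eq, if_pos (by simp)]

theorem prob_swap (p : Ω → ℝ) (X : Ω → α) (Y : Ω → β) (x : α) (y : β) :
    prob p (fun ω => (Y ω, X ω)) (y, x) = prob p (fun ω => (X ω, Y ω)) (x, y) :=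
  prob_congr_of_support fun ω _ => by simp [and_comm]

/-- The factors need not be normalized: their total masses `A` and `B` multiply to 1. -/
theorem mutualInfo_eq_zero_of_prob_eq_mul (hp : p ∈ stdSimplex ℝ Ω) (f : α → ℝ) (g : β → ℝ)
    (h : ∀ x y, prob p (fun ω => (X ω, Y ω)) (x, y) = f x * g y) : mutualInfo p X Y = 0 := by
  set A := ∑ x ∈ (Set.finite_range X).toFinset, f x
  set B := ∑ y ∈ (Set.finite_range Y).toFinset, g y
  have hX : ∀ x, prob p X x = f x * B := fun x => by
    rw [← sum_prob_pair p X Y x, Finset.mul_sum]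
    exact Finset.sum_congr rfl fun y _ => h x y
  have hY : ∀ y, prob p Y y = A * g y := fun y => by
    rw [← sum_prob_pair p Y X y, Finset.sum_mul]
    exact Finset.sum_congr rfl fun x _ => by rw [prob_swap, h]
  have hAB : A * B = 1 := by
    rw [← hp.2, ← sum_prob p X, Finset.sum_mul]
    exact Finset.sum_congr rfl fun x _ => (hX x).symm
  have hmul : ∀ x y, prob p (fun ω => (X ω, Y ω)) (x, y) = prob p X x * prob p Y y := by
    intro x y
    rw [h, hX, hY, show f x * B * (A * g y) = (A * B) * (f x * g y) by ring, hAB, one_mul]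
  unfold mutualInfo
  simp only [entropy_eq_sum, ← Finset.sum_add_distrib, ← Finset.sum_sub_distrib]
  refine Finset.sum_eq_zero fun ω _ => ?_
  by_cases hω : p ω = 0
  · simp [hω]
  rw [hmul, Real.log_mul (prob_pos hp.1 X hω).ne' (prob_pos hp.1 Y hω).ne']
  ring

/-- A law-preserving injection maps an event into another one of at least its probability. -/
theorem prob_le_of_injective (hp : ∀ ω, 0 ≤ p ω) (X : Ω → α) (Y : Ω → β) {x : α} {y : β}
    (σ : Ω → Ω) (hσ : Function.Injective σ) (hpσ : ∀ ω, p (σ ω) = p ω)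
    (h : ∀ ω, X ω = x → Y (σ ω) = y) : prob p X x ≤ prob p Y y := by
  classical
  rw [prob_eq_sum_ite, prob_eq_sum_ite,
    ← (Equiv.ofBijective σ (Finite.injective_iff_bijective.1 hσ)).sum_comp
      (fun ω => if Y ω = y then p ω else 0)]
  refine Finset.sum_le_sum fun ω _ => ?_
  simp only [Equiv.ofBijective_apply]
  by_cases hx : X ω = x
  · simp [hx, h ω hx, hpσ]
  · simp only [hx, if_false]
    split_ifs <;> simp [hp]

/-- `X` and `Y` are independent when all values of `X` are related by symmetries of the law that
fix `Y`. -/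
theorem mutualInfo_eq_zero_of_symmetry (hp : p ∈ stdSimplex ℝ Ω)
    (h : ∀ x x', ∃ σ : Ω → Ω, Function.Injective σ ∧ (∀ ω, p (σ ω) = p ω) ∧
      (∀ ω, Y (σ ω) = Y ω) ∧ ∀ ω, X ω = x → X (σ ω) = x') : mutualInfo p X Y = 0 := by
  have hle : ∀ x x' y, prob p (fun ω => (X ω, Y ω)) (x, y)
      ≤ prob p (fun ω => (X ω, Y ω)) (x', y) := by
    intro x x' y
    obtain ⟨σ, h1, h2, h3, h4⟩ := h x x'
    refine prob_le_of_injective hp.1 _ _ σ h1 h2 fun ω hω => ?_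
    simp only [Prod.mk.injEq] at hω ⊢
    exact ⟨h4 ω hω.1, (h3 ω).trans hω.2⟩
  have hne : Nonempty Ω := by
    by_contra hemp
    rw [not_nonempty_iff] at hemp
    have := hp.2
    simp at this
  obtain ⟨ω₀⟩ := hne
  refine mutualInfo_eq_zero_of_prob_eq_mul hp (fun _ => 1)
    (fun y => prob p (fun ω => (X ω, Y ω)) (X ω₀, y)) fun x y => ?_
  rw [one_mul]
  exact le_antisymm (hle _ _ _) (hle _ _ _)

theorem entropy_le_log_card [Fintype α] (hp : p ∈ stdSimplex ℝ Ω) (X : Ω → α) :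
    entropy p X ≤ Real.log (Fintype.card α) := by
  classical
  have hne : Nonempty Ω := by
    by_contra hemp
    rw [not_nonempty_iff] at hemp
    have := hp.2
    simp at this
  have : Nonempty α := hne.map X
  have hc : (0 : ℝ) < Fintype.card α := by exact_mod_cast Fintype.card_pos
  have h1 : ∀ ω, p ω * (-Real.log (prob p X (X ω))) ≤ p ω * Real.log (Fintype.card α)
      + (p ω / prob p X (X ω) / Fintype.card α - p ω) := by
    intro ω
    by_cases hω : p ω = 0
    · simp [hω]
    have hP := prob_pos hp.1 X hω
    -- Gibbs' inequality against the uniform law.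
    have := Real.log_le_sub_one_of_pos (x := (prob p X (X ω) * Fintype.card α)⁻¹)
      (by positivity)
    rw [Real.log_inv, Real.log_mul hP.ne' hc.ne'] at this
    have h2 := mul_le_mul_of_nonneg_left this (hp.1 ω)
    have h3 : p ω * ((prob p X (X ω) * Fintype.card α)⁻¹ - 1)
      = p ω / prob p X (X ω) / Fintype.card α - p ω := by field_simp
    linarith
  have h2 : ∑ ω, p ω / prob p X (X ω) ≤ Fintype.card α := by
    have : ∀ ω, p ω / prob p X (X ω)
        = ∑ x, (if X ω = x then p ω else 0) / prob p X x := by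
      intro ω
      simp_rw [ite_div, zero_div]
      simp
    simp_rw [this]
    rw [Finset.sum_comm]
    simp_rw [← Finset.sum_div, ← prob_eq_sum_ite]
    calc _ ≤ ∑ x : α, (1 : ℝ) := Finset.sum_le_sum fun x _ => div_self_le_one _
      _ = _ := by simp
  rw [entropy_eq_sum]
  calc _ ≤ _ := Finset.sum_le_sum fun ω _ => h1 ω
    _ = Real.log (Fintype.card α) + ((∑ ω, p ω / prob p X (X ω)) / Fintype.card α - 1) := by
      rw [Finset.sum_add_distrib, Finset.sum_sub_distrib, ← Finset.sum_mul, ← Finset.sum_div,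
        hp.2, one_mul]
    _ ≤ _ := by
      have := (div_le_one hc).2 h2
      linarith

theorem entropy_eq_log_card [Fintype α] (hp : p ∈ stdSimplex ℝ Ω) (X : Ω → α)
    (h : ∀ x x', ∃ σ : Ω → Ω, Function.Injective σ ∧ (∀ ω, p (σ ω) = p ω) ∧
      ∀ ω, X ω = x → X (σ ω) = x') : entropy p X = Real.log (Fintype.card α) := by
  classical
  have hle : ∀ x x', prob p X x ≤ prob p X x' := by
    intro x x'
    obtain ⟨σ, h1, h2, h4⟩ := h x x'
    exact prob_le_of_injective hp.1 _ _ σ h1 h2 h4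
  have hs : ∑ x, prob p X x = 1 := by
    simp_rw [prob_eq_sum_ite]
    rw [Finset.sum_comm]
    simpa using hp.2
  have hP : ∀ x, prob p X x = (Fintype.card α : ℝ)⁻¹ := by
    intro x
    rw [Finset.sum_congr rfl fun x' _ => le_antisymm (hle x' x) (hle x x')] at hs
    simp only [Finset.sum_const, Finset.card_univ, nsmul_eq_mul] at hs
    exact eq_inv_of_mul_eq_one_right hs
  rw [entropy_eq_sum]
  simp_rw [hP]
  rw [← Finset.sum_mul, hp.2, Real.log_inv]
  ring

end Conditional

section DataProcessing

variable {Ω α β α' β' : Type*} [Fintype Ω] {p : Ω → ℝ}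

/-- Functions of independent variables are independent: submodularity is used once to pass from `X`
to `X'` and once to pass from `Y` to `Y'`. -/
theorem entropy_add_le_of_mutualInfo_eq_zero (hp : p ∈ stdSimplex ℝ Ω) {X : Ω → α} {Y : Ω → β}
    (h : mutualInfo p X Y = 0) (X' : Ω → α') (Y' : Ω → β')
    (hX : ∀ ω ω', X ω = X ω' → X' ω = X' ω') (hY : ∀ ω ω', Y ω = Y ω' → Y' ω = Y' ω') :
    entropy p X' + entropy p Y' ≤ entropy p (fun ω => (X' ω, Y' ω)) := by
  unfold mutualInfo at h
  have h1 := entropy_submodular X Y X' hp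
  have h2 := entropy_submodular Y X' Y' hp
  have e1 : entropy p (fun ω => (X ω, Y ω)) ≤ entropy p (fun ω => (X ω, Y ω, X' ω)) :=
    entropy_le_of_determines hp.1 (by simp +contextual)
  have e2 : entropy p (fun ω => (X ω, X' ω)) ≤ entropy p X :=
    entropy_le_of_determines hp.1 fun ω ω' _ _ e => by simp [e, hX _ _ e]
  have e3 : entropy p (fun ω => (Y ω, X' ω)) ≤ entropy p (fun ω => (Y ω, X' ω, Y' ω)) :=
    entropy_le_of_determines hp.1 (by simp +contextual)
  have e4 : entropy p (fun ω => (Y ω, Y' ω)) ≤ entropy p Y :=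
    entropy_le_of_determines hp.1 fun ω ω' _ _ e => by simp [e, hY _ _ e]
  linarith

end DataProcessing

/-- The indices other than `k`, in increasing order. -/
def otherIndex {K : ℕ} (k : Fin K) : Fin (K - 1) ↪o Fin K :=
  (Finset.univ.erase k).orderEmbOfFin
    (by rw [Finset.card_erase_of_mem (Finset.mem_univ _), Finset.card_fin])

theorem otherIndex_ne {K : ℕ} (k : Fin K) (j : Fin (K - 1)) : otherIndex k j ≠ k :=
  Finset.ne_of_mem_erase (Finset.orderEmbOfFin_mem _ _ j)

theorem exists_otherIndex_eq {K : ℕ} {k i : Fin K} (h : i ≠ k) : ∃ j, otherIndex k j = i := by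
  have : i ∈ Set.range (otherIndex k) := by
    unfold otherIndex
    rw [Finset.range_orderEmbOfFin]
    simp [h]
  exact this

/-! ### Converse: entropy inequalities for a fixed realization of the user's randomness. -/

namespace Protocol

variable {F : Type} {K N : ℕ} (P : Protocol F K N)

theorem exists_userProb_ne_zero : ∃ u, P.userProb u ≠ 0 := by
  by_contra! h
  have := P.userProb_mem.2
  simp [h] at this

variable [Fintype F]

/-- The joint law of the database and the common randomness. -/
def serverLaw (x : P.Database × P.CommonRand) : ℝ :=
  (Fintype.card P.Database : ℝ)⁻¹ * P.commonProb x.2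

theorem law_eq (i : Fin K) (u : P.UserRand) (x : P.Database × P.CommonRand) :
    P.law (i, u, x) = (K : ℝ)⁻¹ * P.userProb u * P.serverLaw x := by
  simp only [law, serverLaw, userRand, commonRand, mul_assoc]

theorem sum_sample (g : P.Sample → ℝ) :
    ∑ ω, g ω = ∑ i, ∑ u, ∑ x : P.Database × P.CommonRand, g (i, u, x) := by
  simp only [Fintype.sum_prod_type]

theorem law_ne_zero (hK : 0 < K) {i : Fin K} {u : P.UserRand} {x : P.Database × P.CommonRand}
    (hu : P.userProb u ≠ 0) (hx : P.serverLaw x ≠ 0) : P.law (i, u, x) ≠ 0 := by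
  rw [law_eq]
  have : (K : ℝ) ≠ 0 := by exact_mod_cast hK.ne'
  positivity

theorem prob_law {α : Type*} (X : P.Sample → α) (y : α) :
    prob P.law X y = ∑ i, ∑ u, (K : ℝ)⁻¹ * P.userProb u *
      prob P.serverLaw (fun x => X (i, u, x)) y := by
  classical
  simp only [prob_eq_sum_ite, Finset.mul_sum]
  rw [sum_sample]
  refine Finset.sum_congr rfl fun i _ => Finset.sum_congr rfl fun u _ =>
    Finset.sum_congr rfl fun x _ => ?_
  rw [law_eq]
  split_ifs <;> simp

theorem prob_law_server (hK : 0 < K) {α : Type*} (X : P.Database × P.CommonRand → α) (y : α) :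
    prob P.law (fun ω => X ω.2.2) y = prob P.serverLaw X y := by
  rw [prob_law]
  simp only [← Finset.sum_mul, ← Finset.mul_sum, P.userProb_mem.2, mul_one]
  have : (K : ℝ) ≠ 0 := by exact_mod_cast hK.ne'
  simp [this]

theorem entropy_law_server (hK : 0 < K) {α : Type*} (X : P.Database × P.CommonRand → α) :
    entropy P.law (fun ω => X ω.2.2) = entropy P.serverLaw X := by
  rw [entropy_eq_sum, entropy_eq_sum, sum_sample]
  simp only [P.prob_law_server hK, law_eq]
  simp only [mul_assoc, ← Finset.mul_sum]
  rw [← Finset.sum_mul, P.userProb_mem.2]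
  have : (K : ℝ) ≠ 0 := by exact_mod_cast hK.ne'
  simp [this]

/-- The answer of server `n` when file `k` is desired, for a fixed realization of the randomness of
the user. -/
def answerAt (u : P.UserRand) (k : Fin K) (n : Fin N) (x : P.Database × P.CommonRand) :
    P.Answer n :=
  P.answer n (P.query n k u) x.1 (P.nodeRand n x.2)

/-- The answers of all servers but `2 B` determine the desired file. -/
theorem files_eq_of_answerAt_eq (hK : 0 < K) {B : ℕ} (hP : P.ZeroError B) (k : Fin K)
    {u : P.UserRand} (hu : P.userProb u ≠ 0) {s : Finset (Fin N)} (hs : N ≤ s.card + 2 * B)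
    {x x' : P.Database × P.CommonRand} (hx : P.serverLaw x ≠ 0) (hx' : P.serverLaw x' ≠ 0)
    (h : ∀ n ∈ s, P.answerAt u k n x = P.answerAt u k n x') : x.1 k = x'.1 k := by
  classical
  obtain ⟨b, hb, hbc⟩ := Finset.exists_subset_card_eq
    (show min B sᶜ.card ≤ sᶜ.card from min_le_right _ _)
  have hc := Finset.card_compl s
  rw [Fintype.card_fin] at hc
  have h2 : (sᶜ \ b).card ≤ B := by
    rw [Finset.card_sdiff_of_subset hb, hbc]
    omega
  -- A hybrid received word. It differs from the answers for `x'` only on `b`, and from those for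
  -- `x` only on `sᶜ \ b`; both sets have at most `B` elements, so it decodes to both files.
  let y : (n : Fin N) → P.Answer n := fun n =>
    if n ∈ b then P.answerAt u k n x else P.answerAt u k n x'
  have e1 := hP k (k, u, x') (P.law_ne_zero hK hu hx') b (hbc.le.trans (min_le_left _ _)) y
    (fun n hn => if_neg hn)
  have e2 := hP k (k, u, x) (P.law_ne_zero hK hu hx) (sᶜ \ b) h2 y (fun n hn => by
    by_cases hnb : n ∈ b
    · exact if_pos hnb
    · have hns : n ∈ s := by
        by_contra hns
        exact hn (by simp [hns, hnb])
      exact (if_neg hnb).trans (h n hns).symm)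
  exact e2.symm.trans e1

theorem fileEntropy_eq (hK : 0 < K) (k : Fin K) :
    P.fileEntropy k = entropy P.serverLaw (fun x => x.1 k) :=
  P.entropy_law_server hK (fun x => x.1 k)

variable [Nonempty F]

theorem serverLaw_mem : P.serverLaw ∈ stdSimplex ℝ (P.Database × P.CommonRand) := by
  refine ⟨fun x => mul_nonneg (by positivity) (P.commonProb_mem.1 _), ?_⟩
  simp only [serverLaw, Fintype.sum_prod_type, ← Finset.mul_sum, P.commonProb_mem.2]
  simp only [Finset.sum_const, Finset.card_univ, nsmul_eq_mul, mul_one]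
  exact inv_mul_cancel₀ (Nat.cast_ne_zero.2 (Fintype.card_ne_zero (α := P.Database)))

theorem law_mem (hK : 0 < K) : P.law ∈ stdSimplex ℝ P.Sample := by
  refine ⟨fun ω => ?_, ?_⟩
  · obtain ⟨i, u, x⟩ := ω
    rw [law_eq]
    exact mul_nonneg (mul_nonneg (by positivity) (P.userProb_mem.1 _)) (P.serverLaw_mem.1 _)
  · rw [sum_sample]
    simp only [law_eq, ← Finset.mul_sum, P.serverLaw_mem.2, P.userProb_mem.2, mul_one]
    have : (K : ℝ) ≠ 0 := by exact_mod_cast hK.ne'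
    simp [this]

theorem exists_serverLaw_ne_zero : ∃ x, P.serverLaw x ≠ 0 := by
  by_contra! h
  have := P.serverLaw_mem.2
  simp [h] at this

/-- Database-privacy includes the index and all queries in the view, so it survives conditioning on
them. User randomness with the same queries gives the same answers, so this conditioning amounts to
fixing `u`. -/
theorem mutualInfo_otherFiles_answerAt (hK : 0 < K) {B : ℕ} (hP : P.DatabasePrivacy B)
    (k : Fin K) {u : P.UserRand} (hu : P.userProb u ≠ 0) :
    mutualInfo P.serverLaw (fun x j => x.1 (otherIndex k j))
      (fun x n => P.answerAt u k n x) = 0 := by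
  classical
  -- Only the case without tampering is needed.
  have h0 := hP ∅ (by simp) (fun _ a => a) (fun _ _ _ _ => rfl)
  have h1 := prob_mul_prob_of_mutualInfo_eq_zero (P.law_mem hK) h0
  set q : (n : Fin N) → Fin K → P.Query n := fun n k' => P.query n k' u with hq
  -- The probability that the whole collection of queries equals that of `u`.
  set c := ∑ u', if (fun n k' => P.query n k' u') = q then P.userProb u' else 0 with hc
  have hcpos : 0 < c := by
    refine lt_of_lt_of_le (lt_of_le_of_ne (P.userProb_mem.1 u) hu.symm) ?_
    have := Finset.single_le_sum
      (f := fun u' => if (fun n k' => P.query n k' u') = q then P.userProb u' else 0)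
      (fun u' _ => by split_ifs <;> simp [P.userProb_mem.1]) (Finset.mem_univ u)
    simpa [hq] using this
  have hK' : (0 : ℝ) < (K : ℝ)⁻¹ := by positivity
  have h2 : ∀ v a, prob P.law (fun ω => (P.otherFiles ω,
      (fun n => P.answerVar n (P.index ω) ω), P.allQueries ω, P.index ω)) (v, a, q, k)
      = (K : ℝ)⁻¹ * c * prob P.serverLaw
        (fun x => ((fun j => x.1 (otherIndex k j)), (fun n => P.answerAt u k n x))) (v, a) := by
    intro v a
    rw [prob_law, Finset.sum_eq_single k]
    · rw [hc, Finset.mul_sum, Finset.sum_mul]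
      refine Finset.sum_congr rfl fun u' _ => ?_
      by_cases hqq : (fun n k' => P.query n k' u') = q
      · rw [if_pos hqq]
        congr 1
        refine prob_congr_of_support fun x _ => ?_
        have h3 : (fun n => P.answerVar n k (k, u', x)) = fun n => P.answerAt u k n x := by
          funext n
          have := congrFun (congrFun hqq n) k
          simp only [hq] at this
          simp only [answerVar, answerAt, queryVar, userRand, files, commonRand, this]
        have h4 : P.allQueries (k, u', x) = q := hqq
        have h5 : P.otherFiles (k, u', x) = fun j => x.1 (otherIndex k j) := rfl
        simp [index, h3, h4, h5]
      · rw [if_neg hqq]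
        have : prob P.serverLaw (fun x => (P.otherFiles (k, u', x),
            (fun n => P.answerVar n (P.index (k, u', x)) (k, u', x)), P.allQueries (k, u', x),
            P.index (k, u', x))) (v, a, q, k) = 0 := by
          by_contra hne
          obtain ⟨x, -, hx⟩ := exists_of_prob_ne_zero hne
          simp only [Prod.mk.injEq] at hx
          exact hqq hx.2.2.1
        rw [this]
        ring
    · intro i _ hi
      refine Finset.sum_eq_zero fun u' _ => ?_
      have : prob P.serverLaw (fun x => (P.otherFiles (i, u', x),
            (fun n => P.answerVar n (P.index (i, u', x)) (i, u', x)), P.allQueries (i, u', x),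
            P.index (i, u', x))) (v, a, q, k) = 0 := by
          by_contra hne
          obtain ⟨x, -, hx⟩ := exists_of_prob_ne_zero hne
          simp only [Prod.mk.injEq] at hx
          exact hi hx.2.2.2
      rw [this, mul_zero]
    · simp
  refine mutualInfo_eq_zero_of_prob_eq_mul P.serverLaw_mem
    (fun v => ((K : ℝ)⁻¹ * c)⁻¹ * prob P.law P.otherFiles v)
    (fun a => prob P.law (fun ω => ((fun n => P.answerVar n (P.index ω) ω), P.allQueries ω,
      P.index ω)) (a, q, k)) fun v a => ?_
  have h3 := (h2 v a).symm.trans (h1 v (a, q, k))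
  rw [mul_assoc _ (prob P.law P.otherFiles v), ← h3, inv_mul_cancel_left₀ (by positivity)]

theorem exists_query_eq (hK : 0 < K) {T : ℕ} (hP : P.UserPrivacy T) {𝒯 : Finset (Fin N)}
    (h𝒯 : 𝒯.card = T) (k k' : Fin K) {u : P.UserRand} (hu : P.userProb u ≠ 0) :
    ∃ u', P.userProb u' ≠ 0 ∧ ∀ n ∈ 𝒯, P.query n k' u' = P.query n k u := by
  obtain ⟨x, hx⟩ := P.exists_serverLaw_ne_zero
  have hl := P.law_mem hK
  have h1 := prob_mul_prob_of_mutualInfo_eq_zero hl (hP 𝒯 h𝒯)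
  -- Independence gives positive probability to the index `k'` together with the view produced by
  -- `k` and `u`; any realization of this event supplies `u'`.
  have h2 := h1 (P.index (k', u, x)) _ ▸ mul_ne_zero
    (prob_pos hl.1 P.index (P.law_ne_zero hK (i := k') hu hx)).ne'
    (prob_pos hl.1 (fun ω => ((fun n : 𝒯 => P.queryVar n (P.index ω) ω),
      (fun n : 𝒯 => P.answerVar n (P.index ω) ω), P.files ω, P.commonRand ω))
      (P.law_ne_zero hK (i := k) hu hx)).ne'
  obtain ⟨⟨i, u', x'⟩, hω, he⟩ := exists_of_prob_ne_zero h2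
  simp only [Prod.mk.injEq] at he
  have hi : i = k' := he.1
  subst hi
  rw [law_eq] at hω
  refine ⟨u', right_ne_zero_of_mul (left_ne_zero_of_mul hω), fun n hn => ?_⟩
  exact congrFun he.2.1 ⟨n, hn⟩

/-- The entropy of the answers of a set of servers, for a fixed realization of the randomness of
the user. -/
def answerEntropy (u : P.UserRand) (k : Fin K) (s : Finset (Fin N)) : ℝ :=
  entropy P.serverLaw (fun x (n : s) => P.answerAt u k n x)

/-- The answers of `t` could equally belong to a request for `k' ≠ k`, for which `W_k` must stay
hidden; so they are independent of `W_k`. The answers of `s` determine both. -/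
theorem fileEntropy_add_answerEntropy_le (hK : 2 ≤ K) {B T : ℕ} (hP : P.IsTBSPIR T B)
    (k : Fin K) {u : P.UserRand} (hu : P.userProb u ≠ 0) {t s : Finset (Fin N)}
    (ht : t.card = T) (hts : t ⊆ s) (hs : N ≤ s.card + 2 * B) :
    P.fileEntropy k + P.answerEntropy u k t ≤ P.answerEntropy u k s := by
  have hK0 : 0 < K := by omega
  have : Nontrivial (Fin K) := Fin.nontrivial_iff_two_le.2 hK
  obtain ⟨k', hk'⟩ := exists_ne k
  obtain ⟨u', hu', hq⟩ := P.exists_query_eq hK0 hP.userPrivacy ht k k' hu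
  have h1 := P.mutualInfo_otherFiles_answerAt hK0 hP.databasePrivacy k' hu'
  obtain ⟨j, hj⟩ := exists_otherIndex_eq hk'.symm
  have h2 := entropy_add_le_of_mutualInfo_eq_zero P.serverLaw_mem h1 (fun x => x.1 k)
    (fun x (n : t) => P.answerAt u k n x)
    (fun x x' h => by simpa [hj] using congrFun h j)
    (fun x x' h => by
      funext n
      have := congrFun h n
      simpa [answerAt, hq n n.2] using this)
  rw [P.fileEntropy_eq hK0]
  refine h2.trans (entropy_le_of_determines P.serverLaw_mem.1 fun x x' hx hx' h => ?_)
  refine Prod.ext (P.files_eq_of_answerAt_eq hK0 hP.zeroError k hu hs hx hx'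
    fun n hn => congrFun h ⟨n, hn⟩) ?_
  funext n
  exact congrFun h ⟨n, hts n.2⟩

/-- Let `A` be all answers and `W'` the other files. Then `H(W') + H(W_k) + H(A_t) ≤ H(W') + H(A) =
H(W', A) ≤ H(W, S) ≤ H(W') + H(W_k) + H(S)`. -/
theorem answerEntropy_le_entropy_commonRand (hK : 2 ≤ K) {B T : ℕ} (hP : P.IsTBSPIR T B)
    (k : Fin K) {u : P.UserRand} (hu : P.userProb u ≠ 0) {t : Finset (Fin N)}
    (ht : t.card = T) : P.answerEntropy u k t ≤ entropy P.law P.commonRand := by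
  have hK0 : 0 < K := by omega
  have hm := P.serverLaw_mem
  have h1 := P.fileEntropy_add_answerEntropy_le hK hP k hu ht (Finset.subset_univ t)
    (by simp)
  have h2 := entropy_add_le_of_mutualInfo_eq_zero hm
    (P.mutualInfo_otherFiles_answerAt hK0 hP.databasePrivacy k hu)
    (fun x j => x.1 (otherIndex k j)) (fun x (n : (Finset.univ : Finset (Fin N))) =>
      P.answerAt u k n x) (fun _ _ h => h) (fun x x' h => by
        funext n
        exact congrFun h n)
  have h3 : entropy P.serverLaw (fun x => ((fun j => x.1 (otherIndex k j)),
      (fun (n : (Finset.univ : Finset (Fin N))) => P.answerAt u k n x)))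
      ≤ entropy P.serverLaw (fun x => (x.1, x.2)) :=
    entropy_le_of_determines hm.1 fun x x' _ _ h => by
      rw [show x = x' from h]
  have h4 := entropy_pair_le (fun x : P.Database × P.CommonRand => x.1) (fun x => x.2) hm
  have h5 : entropy P.serverLaw (fun x => x.1)
      ≤ entropy P.serverLaw (fun x => (x.1 k, fun j => x.1 (otherIndex k j))) :=
    entropy_le_of_determines hm.1 fun x x' _ _ h => by
      simp only [Prod.mk.injEq] at h
      funext i
      by_cases hi : i = k
      · rw [hi, h.1]
      · obtain ⟨j, rfl⟩ := exists_otherIndex_eq hi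
        exact congrFun h.2 j
  have h6 := entropy_pair_le (fun x : P.Database × P.CommonRand => x.1 k)
    (fun x j => x.1 (otherIndex k j)) hm
  have h7 : entropy P.law P.commonRand = entropy P.serverLaw (fun x => x.2) :=
    P.entropy_law_server hK0 (fun x => x.2)
  rw [P.fileEntropy_eq hK0] at h1
  unfold answerEntropy at h1 ⊢
  rw [h7]
  linarith

theorem answerEntropy_empty (u : P.UserRand) (k : Fin K) : P.answerEntropy u k ∅ = 0 := by
  refine le_antisymm ?_ (entropy_nonneg P.serverLaw_mem _)
  rw [← entropy_const P.serverLaw_mem ()]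
  refine entropy_le_of_determines P.serverLaw_mem.1 fun x x' _ _ _ => ?_
  funext n
  exact absurd n.2 (Finset.notMem_empty _)

/-- Submodularity as diminishing returns: `n` adds no more entropy to `s` than to its subset `c`. -/
theorem answerEntropy_insert_le (u : P.UserRand) (k : Fin K) (n : Fin N) {c s : Finset (Fin N)}
    (h : c ⊆ s) : P.answerEntropy u k (insert n s) + P.answerEntropy u k c
      ≤ P.answerEntropy u k s + P.answerEntropy u k (insert n c) := by
  have hm := P.serverLaw_mem
  have h1 := entropy_submodular (fun x => P.answerAt u k n x)
    (fun x (n : s) => P.answerAt u k n x) (fun x (n : c) => P.answerAt u k n x) hm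
  have h2 : P.answerEntropy u k (insert n s) ≤ entropy P.serverLaw (fun x =>
      (P.answerAt u k n x, (fun (n : s) => P.answerAt u k n x),
        (fun (n : c) => P.answerAt u k n x))) :=
    entropy_le_of_determines hm.1 fun x x' _ _ e => by
      simp only [Prod.mk.injEq] at e
      funext ⟨m, hm⟩
      rcases Finset.mem_insert.1 hm with rfl | hm
      · exact e.1
      · exact congrFun e.2.1 ⟨m, hm⟩
  have h3 : entropy P.serverLaw (fun x => (P.answerAt u k n x,
      (fun (n : c) => P.answerAt u k n x))) ≤ P.answerEntropy u k (insert n c) :=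
    entropy_le_of_determines hm.1 fun x x' _ _ e => by
      refine Prod.ext (congrFun e ⟨n, Finset.mem_insert_self _ _⟩) ?_
      funext m
      exact congrFun e ⟨m, Finset.mem_insert_of_mem m.2⟩
  have h4 : entropy P.serverLaw (fun x => ((fun (n : s) => P.answerAt u k n x),
      (fun (n : c) => P.answerAt u k n x))) ≤ P.answerEntropy u k s :=
    entropy_le_of_determines hm.1 fun x x' _ _ e => by
      refine Prod.ext e ?_
      funext m
      exact congrFun e ⟨m, h m.2⟩
  have h5 : P.answerEntropy u k c = entropy P.serverLaw
    (fun x (n : c) => P.answerAt u k n x) := rfl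
  linarith

theorem answerEntropy_union_le (u : P.UserRand) (k : Fin K) {c s : Finset (Fin N)}
    (h : c ⊆ s) (d : Finset (Fin N)) : P.answerEntropy u k (s ∪ d) ≤ P.answerEntropy u k s
      + ∑ n ∈ d, (P.answerEntropy u k (insert n c) - P.answerEntropy u k c) := by
  induction d using Finset.induction_on with
  | empty => simp
  | insert n d hn ih =>
    rw [Finset.sum_insert hn, Finset.union_insert]
    have := P.answerEntropy_insert_le u k n (h.trans (Finset.subset_union_left (s₂ := d)))
    linarith

theorem answerEntropy_singleton (u : P.UserRand) (k : Fin K) (n : Fin N) :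
    P.answerEntropy u k {n} = entropy P.serverLaw (P.answerAt u k n) := by
  refine entropy_congr P.serverLaw_mem.1 fun x x' _ _ => ?_
  refine ⟨fun h => congrFun h ⟨n, Finset.mem_singleton_self n⟩, fun h => ?_⟩
  funext ⟨m, hm⟩
  obtain rfl := Finset.mem_singleton.1 hm
  exact h

/-- Conditioning on the randomness of the user does not increase the entropy of an answer. -/
theorem sum_userProb_mul_entropy_le (hK : 0 < K) (k : Fin K) (n : Fin N) :
    ∑ u, P.userProb u * entropy P.serverLaw (P.answerAt u k n)
      ≤ entropy P.law (P.answerVar n k) := by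
  classical
  have hl := P.law_mem hK
  have hK' : (K : ℝ) ≠ 0 := by exact_mod_cast hK.ne'
  have h1 := entropy_pair_le (P.answerVar n k) P.userRand hl
  have hU : ∀ u, prob P.law P.userRand u = P.userProb u := by
    intro u
    have : ∀ (i : Fin K) (u' : P.UserRand),
        prob P.serverLaw (fun x => P.userRand (i, u', x)) u = if u' = u then 1 else 0 := by
      intro i u'
      simp only [userRand, prob_eq_sum_ite]
      split_ifs
      · exact P.serverLaw_mem.2
      · simp
    rw [prob_law]
    simp [this, hK']
  have hAU : ∀ a u, prob P.law (fun ω => (P.answerVar n k ω, P.userRand ω)) (a, u)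
      = P.userProb u * prob P.serverLaw (P.answerAt u k n) a := by
    intro a u
    have : ∀ (i : Fin K) (u' : P.UserRand),
        prob P.serverLaw (fun x => (P.answerVar n k (i, u', x), P.userRand (i, u', x))) (a, u)
          = if u' = u then prob P.serverLaw (P.answerAt u k n) a else 0 := by
      intro i u'
      split_ifs with h
      · subst h
        exact prob_congr_of_support fun x _ => by
          simp [answerVar, answerAt, userRand, queryVar, files, commonRand]
      · by_contra hne
        obtain ⟨x, -, hx⟩ := exists_of_prob_ne_zero hne
        simp only [Prod.mk.injEq] at hx
        exact h hx.2
    rw [prob_law]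
    simp only [this, mul_ite, mul_zero, Finset.sum_ite_eq', Finset.mem_univ, if_true,
      Finset.sum_const, Finset.card_univ, Fintype.card_fin, nsmul_eq_mul]
    field_simp
  -- Chain rule, with the law of the answer given `U = u` written as its law under `serverLaw`.
  have h2 : entropy P.law (fun ω => (P.answerVar n k ω, P.userRand ω))
      = entropy P.law P.userRand
        + ∑ u, P.userProb u * entropy P.serverLaw (P.answerAt u k n) := by
    have h3 : ∀ ω, P.law ω * (-Real.log (prob P.law
        (fun ω => (P.answerVar n k ω, P.userRand ω)) (P.answerVar n k ω, P.userRand ω)))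
        = P.law ω * (-Real.log (prob P.law P.userRand (P.userRand ω)))
        + P.law ω * (-Real.log (prob P.serverLaw (P.answerAt (P.userRand ω) k n)
            (P.answerVar n k ω))) := by
      intro ω
      by_cases hω : P.law ω = 0
      · simp [hω]
      have h4 := (prob_pos hl.1 (fun ω => (P.answerVar n k ω, P.userRand ω)) hω).ne'
      rw [hAU] at h4 ⊢
      rw [hU, Real.log_mul (left_ne_zero_of_mul h4) (right_ne_zero_of_mul h4)]
      ring
    rw [entropy_eq_sum, Finset.sum_congr rfl fun ω _ => h3 ω, Finset.sum_add_distrib,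
      ← entropy_eq_sum, P.sum_sample]
    congr 1
    have h5 : ∀ (i : Fin K) (u : P.UserRand) (x : P.Database × P.CommonRand),
        P.law (i, u, x) * (-Real.log (prob P.serverLaw (P.answerAt (P.userRand (i, u, x)) k n)
            (P.answerVar n k (i, u, x))))
        = (K : ℝ)⁻¹ * (P.userProb u * (P.serverLaw x * (-Real.log (prob P.serverLaw
          (P.answerAt u k n) (P.answerAt u k n x))))) := by
      intro i u x
      rw [law_eq, mul_assoc, mul_assoc]
      rfl
    simp only [h5, ← Finset.mul_sum, ← entropy_eq_sum, Finset.sum_const, Finset.card_univ,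
      Fintype.card_fin, nsmul_eq_mul]
    field_simp
  linarith

theorem fileEntropy_le_sum_answer (hK : 2 ≤ K) {B T : ℕ} (hP : P.IsTBSPIR T B) (k : Fin K)
    {d : Finset (Fin N)} (hd : d.card + 2 * B + T = N) :
    P.fileEntropy k ≤ ∑ n ∈ d, entropy P.law (P.answerVar n k) := by
  classical
  have hK0 : 0 < K := by omega
  have hc := Finset.card_compl d
  rw [Fintype.card_fin] at hc
  -- The inequality is applied to `t ∪ d`, which has exactly `N - 2B` servers.
  obtain ⟨t, ht, htc⟩ := Finset.exists_subset_card_eq (show T ≤ dᶜ.card by omega)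
  have hdisj : Disjoint t d := (Finset.subset_compl_iff_disjoint_right.1 ht)
  have h1 : ∀ u, P.userProb u * P.fileEntropy k
      ≤ ∑ n ∈ d, P.userProb u * entropy P.serverLaw (P.answerAt u k n) := by
    intro u
    by_cases hu : P.userProb u = 0
    · simp [hu]
    rw [← Finset.mul_sum]
    refine mul_le_mul_of_nonneg_left ?_ (P.userProb_mem.1 u)
    have h2 := P.fileEntropy_add_answerEntropy_le hK hP k hu htc
      (Finset.subset_union_left (s₂ := d))
      (by rw [Finset.card_union_of_disjoint hdisj]; omega)
    have h3 := P.answerEntropy_union_le u k (Finset.empty_subset t) d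
    simp only [insert_empty_eq, answerEntropy_singleton, answerEntropy_empty, sub_zero] at h3
    linarith
  calc P.fileEntropy k = ∑ u, P.userProb u * P.fileEntropy k := by
        rw [← Finset.sum_mul, P.userProb_mem.2, one_mul]
    _ ≤ ∑ u, ∑ n ∈ d, P.userProb u * entropy P.serverLaw (P.answerAt u k n) :=
        Finset.sum_le_sum fun u _ => h1 u
    _ = ∑ n ∈ d, ∑ u, P.userProb u * entropy P.serverLaw (P.answerAt u k n) := Finset.sum_comm
    _ ≤ _ := Finset.sum_le_sum fun n _ => P.sum_userProb_mul_entropy_le hK0 k n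

/-- Some `T` servers send answers of entropy at least `T / (N - 2 B - T)` times that of a file. -/
theorem exists_le_answerEntropy (hK : 2 ≤ K) {B T M : ℕ} (hP : P.IsTBSPIR T B) (k : Fin K)
    {u : P.UserRand} (hu : P.userProb u ≠ 0) (hN : M + 2 * B + T = N) (hM : 0 < M) {j : ℕ}
    (hj : j ≤ T) : ∃ c : Finset (Fin N), c.card = j ∧
      j * (P.fileEntropy k / M) ≤ P.answerEntropy u k c := by
  classical
  induction j with
  | zero => exact ⟨∅, rfl, by simp [answerEntropy_empty]⟩
  | succ j ih =>
    obtain ⟨c, hc, hle⟩ := ih (by omega)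
    obtain ⟨t, hct, ht⟩ := Finset.exists_superset_card_eq (s := c) (n := T) (by omega)
      (by rw [Fintype.card_fin]; omega)
    have hcc := Finset.card_compl t
    rw [Fintype.card_fin] at hcc
    obtain ⟨d, hd, hdc⟩ := Finset.exists_subset_card_eq (show M ≤ tᶜ.card by omega)
    have hdisj : Disjoint t d := (Finset.subset_compl_iff_disjoint_left.1 hd)
    have h2 := P.fileEntropy_add_answerEntropy_le hK hP k hu ht
      (Finset.subset_union_left (s₂ := d))
      (by rw [Finset.card_union_of_disjoint hdisj]; omega)
    have h3 := P.answerEntropy_union_le u k hct d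
    have hM' : (0 : ℝ) < M := by exact_mod_cast hM
    -- Adding `d` to `t` gains at least one file entropy. By diminishing returns the `M` separate
    -- gains over `c` sum to at least as much, so one of them is at least the average.
    obtain ⟨n, hn, h4⟩ : ∃ n ∈ d, P.fileEntropy k / M
        ≤ P.answerEntropy u k (insert n c) - P.answerEntropy u k c := by
      refine Finset.exists_le_of_sum_le (Finset.card_pos.1 (by omega)) ?_
      rw [Finset.sum_const, hdc, nsmul_eq_mul, mul_div_cancel₀ _ hM'.ne']
      linarith
    refine ⟨insert n c, ?_, ?_⟩
    · rw [Finset.card_insert_of_notMem, hc]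
      exact fun hnc => Finset.disjoint_left.1 hdisj (hct hnc) hn
    · push_cast
      linarith

end Protocol

/-- Averaging over the `N` cyclic shifts of one set of size `M` suffices: each server is covered `M`
times. -/
theorem card_mul_le_of_forall_card_eq {N M : ℕ} (hN : 0 < N) (hM : M ≤ N) (a : Fin N → ℝ)
    (L : ℝ) (h : ∀ d : Finset (Fin N), d.card = M → L ≤ ∑ n ∈ d, a n) :
    N * L ≤ M * ∑ n, a n := by
  classical
  have : NeZero N := ⟨hN.ne'⟩
  obtain ⟨d, -, hd⟩ := Finset.exists_subset_card_eq
    (show M ≤ (Finset.univ : Finset (Fin N)).card by simpa using hM)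
  calc (N : ℝ) * L = ∑ _c : Fin N, L := by simp
    _ ≤ ∑ c : Fin N, ∑ n ∈ d, a (n + c) := Finset.sum_le_sum fun c _ => by
        have := h (d.map (Equiv.addRight c).toEmbedding) (by simpa using hd)
        simpa using this
    _ = ∑ n ∈ d, ∑ c : Fin N, a (n + c) := Finset.sum_comm
    _ = ∑ n ∈ d, ∑ m, a m := Finset.sum_congr rfl fun n _ => Equiv.sum_comp (Equiv.addLeft n) a
    _ = _ := by rw [Finset.sum_const, hd, nsmul_eq_mul]

/-! ### Converse: bounds on the rate and the secrecy rate. -/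

namespace Protocol

variable {F : Type} [Fintype F] [Nontrivial F] {K N : ℕ} (P : Protocol F K N)

theorem fileEntropy_eq_log (hK : 0 < K) (k : Fin K) :
    P.fileEntropy k = Real.log (Fintype.card P.File) := by
  classical
  rw [P.fileEntropy_eq hK]
  refine entropy_eq_log_card P.serverLaw_mem _ fun w w' => ?_
  refine ⟨fun x => (Function.update x.1 k (Equiv.swap w w' (x.1 k)), x.2), ?_, fun x => rfl, ?_⟩
  · rintro ⟨x, s⟩ ⟨x', s'⟩ h
    simp only [Prod.mk.injEq] at h
    refine Prod.ext (funext fun i => ?_) h.2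
    have := congrFun h.1 i
    by_cases hi : i = k
    · subst hi
      simpa using this
    · simpa [hi] using this
  · rintro x rfl
    simp

theorem fileEntropy_pos (hK : 0 < K) (k : Fin K) : 0 < P.fileEntropy k := by
  rw [P.fileEntropy_eq_log hK]
  refine Real.log_pos ?_
  have : Nonempty (Fin P.fileLength) := ⟨⟨0, P.fileLength_pos⟩⟩
  exact_mod_cast Fintype.one_lt_card

theorem rate_le (hK : 2 ≤ K) {B T : ℕ} (hN : 2 * B + T < N) (hP : P.IsTBSPIR T B) (k : Fin K) :
    P.rate k ≤ ENNReal.ofReal (1 - (2 * (B : ℝ) + T) / N) := by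
  have hK0 : 0 < K := by omega
  obtain ⟨M, hM⟩ : ∃ M, M + 2 * B + T = N := ⟨N - 2 * B - T, by omega⟩
  have h1 := card_mul_le_of_forall_card_eq (by omega) (by omega : M ≤ N)
    (fun n => entropy P.law (P.answerVar n k)) (P.fileEntropy k)
    (fun d hd => P.fileEntropy_le_sum_answer hK hP k (by omega))
  have hL := P.fileEntropy_pos hK0 k
  have hN0 : (0 : ℝ) < N := by exact_mod_cast (by omega : 0 < N)
  have hM0 : (0 : ℝ) < M := by exact_mod_cast (by omega : 0 < M)
  -- The denominator of the rate must be positive, as otherwise the rate would be infinite.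
  have hS : 0 < ∑ n, entropy P.law (P.answerVar n k) := by
    by_contra! h
    have := mul_nonpos_of_nonneg_of_nonpos hM0.le h
    have := mul_pos hN0 hL
    linarith
  unfold rate
  rw [← ENNReal.ofReal_div_of_pos hS]
  refine ENNReal.ofReal_le_ofReal ?_
  have hM' : (M : ℝ) + 2 * B + T = N := by exact_mod_cast hM
  have : 1 - (2 * (B : ℝ) + T) / N = M / N := by
    field_simp
    linarith
  rw [this, div_le_div_iff₀ hS hN0]
  linarith

theorem le_secrecyRate (hK : 2 ≤ K) {B T : ℕ} (hN : 2 * B + T < N) (hP : P.IsTBSPIR T B)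
    (k : Fin K) : (T : ℝ) / ((N : ℝ) - 2 * B - T) ≤ P.secrecyRate k := by
  have hK0 : 0 < K := by omega
  obtain ⟨M, hM⟩ : ∃ M, M + 2 * B + T = N := ⟨N - 2 * B - T, by omega⟩
  obtain ⟨u, hu⟩ := P.exists_userProb_ne_zero
  obtain ⟨c, hc, h1⟩ := P.exists_le_answerEntropy hK hP k hu hM (by omega) le_rfl
  have h2 := P.answerEntropy_le_entropy_commonRand hK hP k hu hc
  have hL := P.fileEntropy_pos hK0 k
  have hM' : (M : ℝ) + 2 * B + T = N := by exact_mod_cast hM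
  rw [show (N : ℝ) - 2 * B - T = M by linarith]
  unfold secrecyRate
  rw [le_div_iff₀ hL]
  calc _ = T * (P.fileEntropy k / M) := by ring
    _ ≤ _ := h1.trans h2

end Protocol

/-- Supplies the padding of the common randomness. The entropy is continuous along the segment from
a point mass to the uniform law on `n + 1 ≥ exp h` points, so the intermediate value theorem
applies. -/
theorem exists_entropy_eq {h : ℝ} (hh : 0 ≤ h) :
    ∃ (n : ℕ) (r : Fin n → ℝ), r ∈ stdSimplex ℝ (Fin n) ∧ ∑ g, Real.negMulLog (r g) = h := by
  obtain ⟨n, hn⟩ := exists_nat_ge (Real.exp h)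
  have hn1 : (0 : ℝ) < n + 1 := by positivity
  let r : ℝ → Fin (n + 1) → ℝ := fun t g => (1 - t) * (if g = 0 then 1 else 0) + t / (n + 1)
  have hcont : Continuous fun t => ∑ g, Real.negMulLog (r t g) :=
    continuous_finsetSum _ fun g _ => Real.continuous_negMulLog.comp (by fun_prop)
  have h0 : ∑ g, Real.negMulLog (r 0 g) = 0 :=
    Finset.sum_eq_zero fun g _ => by
      by_cases hg : g = 0 <;> simp [r, hg]
  have h1 : h ≤ ∑ g, Real.negMulLog (r 1 g) := by
    have : ∑ g, Real.negMulLog (r 1 g) = Real.log (n + 1) := by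
      simp only [r, sub_self, zero_mul, zero_add, Real.negMulLog, one_div, Real.log_inv,
        Finset.sum_const, Finset.card_univ, Fintype.card_fin, nsmul_eq_mul]
      push_cast
      field_simp
    rw [this, Real.le_log_iff_exp_le hn1]
    linarith
  obtain ⟨t, ht, he⟩ := intermediate_value_Icc (zero_le_one (α := ℝ)) hcont.continuousOn
    (show h ∈ Set.Icc _ _ from ⟨h0.le.trans hh, h1⟩)
  refine ⟨n + 1, r t, ⟨fun g => ?_, ?_⟩, he⟩
  · have := ht.1
    have := sub_nonneg.2 ht.2
    dsimp only [r]
    positivity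
  · simp only [r, Finset.sum_add_distrib, ← Finset.mul_sum, Finset.sum_ite_eq', Finset.mem_univ,
      if_true, Finset.sum_const, Finset.card_univ, Fintype.card_fin, nsmul_eq_mul]
    push_cast
    field_simp
    ring

/-! ### Reed-Solomon codes: interpolation and unique decoding. -/

section Interpolation

variable {E : Type} [Field E]

theorem coeff_eq_of_eval_eq {N n : ℕ} {α : Fin N → E} (hα : Function.Injective α)
    {s : Finset (Fin N)} (hs : n ≤ s.card) {c c' : Fin n → E}
    (h : ∀ m ∈ s, ∑ i, c i * α m ^ (i : ℕ) = ∑ i, c' i * α m ^ (i : ℕ)) : c = c' := by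
  obtain ⟨t, hts, ht⟩ := Finset.exists_subset_card_eq hs
  rw [← sub_eq_zero]
  refine Matrix.eq_zero_of_forall_index_sum_pow_mul_eq_zero
    (f := fun j => α (t.equivFinOfCardEq ht |>.symm j))
    (hα.comp (Subtype.val_injective.comp (Equiv.injective _))) fun j => ?_
  have := h _ (hts (t.equivFinOfCardEq ht |>.symm j).2)
  rw [← sub_eq_zero, ← Finset.sum_sub_distrib] at this
  rw [← this]
  exact Finset.sum_congr rfl fun i _ => by simp; ring

/-- Evaluation at `T` distinct points is an injective self-map of a finite set up to reindexing,
hence surjective. -/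
theorem exists_coeff_eval_eq [Finite E] {N T : ℕ} {α : Fin N → E} (hα : Function.Injective α)
    {s : Finset (Fin N)} (hs : s.card = T) (f : Fin N → E) :
    ∃ c : Fin T → E, ∀ m ∈ s, ∑ i, c i * α m ^ (i : ℕ) = f m := by
  have hinj : Function.Injective fun (c : Fin T → E) (j : Fin T) =>
      ∑ i, c i * α ((s.equivFinOfCardEq hs).symm j) ^ (i : ℕ) := by
    intro c c' h
    refine coeff_eq_of_eval_eq hα hs.ge fun m hm => ?_
    simpa using congrFun h (s.equivFinOfCardEq hs ⟨m, hm⟩)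
  obtain ⟨c, hc⟩ := Finite.surjective_of_injective hinj
    (fun j => f ((s.equivFinOfCardEq hs).symm j))
  refine ⟨c, fun m hm => ?_⟩
  simpa using congrFun hc (s.equivFinOfCardEq hs ⟨m, hm⟩)

/-- The evaluation at `a` of the polynomial with coefficients `c` below degree `T`, and `v` from
degree `T` on. -/
def codeEval {T M : ℕ} (c : Fin T → E) (v : Fin M → E) (a : E) : E :=
  ∑ t, c t * a ^ (t : ℕ) + ∑ j, v j * a ^ (T + (j : ℕ))

theorem eq_of_codeEval_eq {N T M : ℕ} {α : Fin N → E} (hα : Function.Injective α)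
    {s : Finset (Fin N)} (hs : T + M ≤ s.card) {c c' : Fin T → E} {v v' : Fin M → E}
    (h : ∀ m ∈ s, codeEval c v (α m) = codeEval c' v' (α m)) : v = v' := by
  have := coeff_eq_of_eval_eq hα hs (c := Fin.append c v) (c' := Fin.append c' v')
    fun m hm => by simpa [Fin.sum_univ_add, codeEval] using h m hm
  funext j
  simpa using congrFun this (Fin.natAdd T j)

open Classical in
/-- The upper coefficients of a codeword at Hamming distance at most `B` from `y`. -/
def codeDecode {N : ℕ} (T M B : ℕ) (α y : Fin N → E) : Fin M → E :=
  if h : ∃ (v : Fin M → E) (c : Fin T → E) (b : Finset (Fin N)), b.card ≤ B ∧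
    ∀ m ∉ b, y m = codeEval c v (α m) then h.choose else 0

/-- Two codewords within distance `B` of `y` agree in at least `N - 2B ≥ T + M` positions, so they
have the same coefficients. -/
theorem codeDecode_eq {N T M B : ℕ} {α : Fin N → E} (hα : Function.Injective α)
    (hN : T + M + 2 * B ≤ N) {y : Fin N → E} {b : Finset (Fin N)} (hb : b.card ≤ B)
    {c : Fin T → E} {v : Fin M → E} (hy : ∀ m ∉ b, y m = codeEval c v (α m)) :
    codeDecode T M B α y = v := by
  have h : ∃ (v : Fin M → E) (c : Fin T → E) (b : Finset (Fin N)), b.card ≤ B ∧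
      ∀ m ∉ b, y m = codeEval c v (α m) := ⟨v, c, b, hb, hy⟩
  rw [codeDecode, dif_pos h]
  obtain ⟨c', b', hb', hc'⟩ := h.choose_spec
  refine eq_of_codeEval_eq hα (s := (b ∪ b')ᶜ) (c := c') (c' := c) ?_ fun m hm => ?_
  · rw [Finset.card_compl, Fintype.card_fin]
    have := Finset.card_union_le b b'
    omega
  · simp only [Finset.compl_union, Finset.mem_inter, Finset.mem_compl] at hm
    rw [← hc' m hm.2, hy m hm.1]

end Interpolation

theorem uniform_mem_stdSimplex (α : Type*) [Fintype α] [Nonempty α] :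
    (fun _ : α => (Fintype.card α : ℝ)⁻¹) ∈ stdSimplex ℝ α :=
  ⟨fun _ => by positivity, by simp⟩

/-! ### Achievability: the coded scheme, its correctness, privacy and rates. -/

section Scheme

variable {F E : Type} [Field E] [Fintype E] {K N T M L n : ℕ}

/-- The scheme with secret-shared queries and answers in a Reed-Solomon code over `E`. Files are
words of length `M` over `E`; the common randomness is `T` uniform symbols of `E`, padded by an
unused variable of law `r`. -/
def codedProtocol (K B T : ℕ) (hL : 0 < L) (e : (Fin L → F) ≃ (Fin M → E)) (α : Fin N → E)
    {r : Fin n → ℝ} (hr : r ∈ stdSimplex ℝ (Fin n)) : Protocol F K N where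
  fileLength := L
  fileLength_pos := hL
  UserRand := Fin K → Fin M → Fin T → E
  userProb _ := (Fintype.card (Fin K → Fin M → Fin T → E) : ℝ)⁻¹
  userProb_mem := uniform_mem_stdSimplex _
  CommonRand := (Fin T → E) × Fin n
  commonProb s := (Fintype.card (Fin T → E) : ℝ)⁻¹ * r s.2
  commonProb_mem := by
    refine ⟨fun s => mul_nonneg (by positivity) (hr.1 _), ?_⟩
    have := (uniform_mem_stdSimplex (Fin T → E)).2
    simp only [Fintype.sum_prod_type, ← Finset.mul_sum, hr.2]
    rw [Finset.mul_sum]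
    simpa only [mul_one] using this
  Query _ := Fin K → Fin M → E
  NodeRand _ := E
  Answer _ := E
  query m k z i j := ∑ t, z i j t * α m ^ (t : ℕ) + if i = k then α m ^ (T + (j : ℕ)) else 0
  nodeRand m s := ∑ t, s.1 t * α m ^ (t : ℕ)
  answer _ q w s := ∑ i, ∑ j, e (w i) j * q i j + s
  decode _ _ y := e.symm (codeDecode T M B α y)

variable {B : ℕ} {hL : 0 < L} {e : (Fin L → F) ≃ (Fin M → E)} {α : Fin N → E}
  {r : Fin n → ℝ} {hr : r ∈ stdSimplex ℝ (Fin n)}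

/-- The share noise only reaches degrees below `T`, and the selection terms put the desired file in
degrees `T` to `T + M - 1`; so the answers form a codeword. -/
theorem codedProtocol_answerAt (u : Fin K → Fin M → Fin T → E) (k : Fin K) (m : Fin N)
    (w : Fin K → Fin L → F) (s : (Fin T → E) × Fin n) :
    (codedProtocol K B T hL e α hr).answerAt u k m (w, s)
      = codeEval (fun t => ∑ i, ∑ j, e (w i) j * u i j t + s.1 t) (e (w k)) (α m) := by
  change ∑ i, ∑ j, e (w i) j * (∑ t, u i j t * α m ^ (t : ℕ)
    + if i = k then α m ^ (T + (j : ℕ)) else 0) + ∑ t, s.1 t * α m ^ (t : ℕ) = _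
  have h1 : ∑ i, ∑ j, e (w i) j * (if i = k then α m ^ (T + (j : ℕ)) else 0)
      = ∑ j, e (w k) j * α m ^ (T + (j : ℕ)) := by
    rw [Finset.sum_eq_single k]
    · simp
    · intro i _ hi
      simp [hi]
    · simp
  have h2 : ∑ i, ∑ j, e (w i) j * ∑ t, u i j t * α m ^ (t : ℕ)
      = ∑ t, (∑ i, ∑ j, e (w i) j * u i j t) * α m ^ (t : ℕ) := by
    simp only [Finset.mul_sum, Finset.sum_mul]
    rw [Finset.sum_congr rfl fun i _ => Finset.sum_comm, Finset.sum_comm]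
    simp only [mul_assoc]
  unfold codeEval
  simp only [mul_add, add_mul, Finset.sum_add_distrib]
  rw [h1, h2]
  ring

theorem codedProtocol_zeroError [Fintype F] (hα : Function.Injective α) (hN : T + M + 2 * B ≤ N) :
    (codedProtocol K B T hL e α hr).ZeroError B := by
  rintro k ⟨i, u, w, s⟩ - b hb y hy
  change e.symm (codeDecode T M B α y) = w k
  exact (Equiv.symm_apply_eq e).2 (codeDecode_eq hα hN hb fun m hm =>
    (hy m hm).trans (codedProtocol_answerAt u k m w s))

theorem codedProtocol_userPrivacy [Fintype F] [Nonempty F] (hK : 0 < K)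
    (hα : Function.Injective α) : (codedProtocol K B T hL e α hr).UserPrivacy T := by
  classical
  intro s hs
  refine mutualInfo_eq_zero_of_symmetry (Protocol.law_mem _ hK) fun k k' => ?_
  -- On the `T` servers of `s`, a change of the desired index is undone by a translation of the
  -- share noise, found by interpolation.
  have hd : ∀ i i' : Fin K, ∃ d : Fin K → Fin M → Fin T → E, ∀ m ∈ s,
      ∀ u : Fin K → Fin M → Fin T → E, (codedProtocol K B T hL e α hr).query m i' (u + d)
        = (codedProtocol K B T hL e α hr).query m i u := by
    intro i i'
    choose d hd using fun (l : Fin K) (j : Fin M) => exists_coeff_eval_eq hα hs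
      (fun m => (if l = i then α m ^ (T + (j : ℕ)) else 0)
        - if l = i' then α m ^ (T + (j : ℕ)) else 0)
    refine ⟨d, fun m hm u => ?_⟩
    funext l j
    change ∑ t, (u l j t + d l j t) * α m ^ (t : ℕ) + (if l = i' then α m ^ (T + (j : ℕ)) else 0)
      = ∑ t, u l j t * α m ^ (t : ℕ) + if l = i then α m ^ (T + (j : ℕ)) else 0
    simp only [add_mul, Finset.sum_add_distrib]
    rw [hd l j m hm]
    ring
  choose d hd using hd
  let shift : Fin K → (Fin K → Fin M → Fin T → E) → Fin K → Fin M → Fin T → E :=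
    fun i u => u + d i (Equiv.swap k k' i)
  refine ⟨fun ω => (Equiv.swap k k' ω.1, shift ω.1 ω.2.1, ω.2.2), ?_,
    fun ω => rfl, ?_, ?_⟩
  · rintro ⟨i, u, x⟩ ⟨i', u', x'⟩ h
    obtain ⟨h1, h⟩ := Prod.ext_iff.1 h
    obtain ⟨h2, h3⟩ := Prod.ext_iff.1 h
    obtain rfl := (Equiv.swap k k').injective h1
    have h3 : x = x' := h3
    have h2 : u = u' := add_right_cancel (G := Fin K → Fin M → Fin T → E) h2
    rw [h2, h3]
  · rintro ⟨i, u, x⟩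
    have hq := fun m (hm : m ∈ s) => hd i (Equiv.swap k k' i) m hm u
    refine Prod.ext (funext fun m => hq m m.2) (Prod.ext (funext fun m => ?_) rfl)
    simp only [Protocol.answerVar, Protocol.queryVar, Protocol.index, Protocol.userRand]
    rw [hq m m.2]
    rfl
  · rintro ⟨i, u, x⟩ rfl
    exact Equiv.swap_apply_left _ _

theorem codedProtocol_databasePrivacy [Fintype F] [Nonempty F] (hK : 0 < K) :
    (codedProtocol K B T hL e α hr).DatabasePrivacy B := by
  classical
  intro b _ tamper _
  refine mutualInfo_eq_zero_of_symmetry (Protocol.law_mem _ hK)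
    fun (v v' : Fin (K - 1) → Fin L → F) => ?_
  -- `ext v i` places `v` at the indices other than `i`; its arbitrary value at `i` is never used,
  -- because `f` leaves file `i` alone.
  let ext : (Fin (K - 1) → Fin L → F) → Fin K → Fin K → Fin L → F := fun v i =>
    Function.extend (otherIndex i) v (fun _ => Classical.arbitrary _)
  let f : Fin K → (Fin K → Fin L → F) → Fin K → Fin L → F := fun i w l =>
    if l = i then w l else Equiv.swap (ext v i l) (ext v' i l) (w l)
  -- The change that `f` causes in the lower coefficients of the answer polynomial. Subtracting it
  -- from the uniform mask leaves every answer fixed.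
  let g : Fin K → (Fin K → Fin M → Fin T → E) → (Fin K → Fin L → F) → Fin T → E :=
    fun i u w t => ∑ l, ∑ j, e (f i w l) j * u l j t - ∑ l, ∑ j, e (w l) j * u l j t
  have hf : ∀ i, Function.Injective (f i) := by
    intro i w w' h
    funext l
    have := congrFun h l
    by_cases hl : l = i
    · simpa only [f, if_pos hl] using this
    · simp only [f, if_neg hl] at this
      exact (Equiv.swap _ _).injective this
  have hanswer : ∀ i (u : Fin K → Fin M → Fin T → E) w (s : (Fin T → E) × Fin n) m,
      (codedProtocol K B T hL e α hr).answerAt u i m (f i w, (s.1 - g i u w, s.2))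
        = (codedProtocol K B T hL e α hr).answerAt u i m (w, s) := by
    intro i u w s m
    refine (codedProtocol_answerAt u i m (f i w) (s.1 - g i u w, s.2)).trans
      (Eq.trans ?_ (codedProtocol_answerAt u i m w s).symm)
    congr 1
    · funext t
      simp only [Pi.sub_apply, g]
      ring
    · exact congrArg e (if_pos rfl)
  refine ⟨fun ω => (ω.1, ω.2.1, f ω.1 ω.2.2.1,
    (ω.2.2.2.1 - g ω.1 ω.2.1 ω.2.2.1, ω.2.2.2.2)), ?_, fun ω => rfl, ?_, ?_⟩
  · rintro ⟨i, u, w, s, c⟩ ⟨i', u', w', s', c'⟩ h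
    obtain ⟨h1, h⟩ := Prod.ext_iff.1 h
    obtain ⟨h2, h⟩ := Prod.ext_iff.1 h
    obtain ⟨h3, h⟩ := Prod.ext_iff.1 h
    obtain ⟨h4, h5⟩ := Prod.ext_iff.1 h
    obtain rfl : i = i' := h1
    obtain rfl : u = u' := h2
    obtain rfl : c = c' := h5
    have h3 : f i w = f i w' := h3
    have hw : w = w' := hf i h3
    subst hw
    rw [show s = s' from sub_left_inj.1 h4]
  · rintro ⟨i, u, w, s⟩
    have : (fun m => (codedProtocol K B T hL e α hr).answerVar m i
        (i, u, f i w, (s.1 - g i u w, s.2)))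
        = fun m => (codedProtocol K B T hL e α hr).answerVar m i (i, u, w, s) :=
      funext fun m => hanswer i u w s m
    refine Prod.ext ?_ rfl
    -- The adversary acts on unchanged queries and answers, so the tampered answers are unchanged as
    -- well.
    exact congrArg (tamper fun m => (codedProtocol K B T hL e α hr).query m i u) this
  · rintro ⟨i, u, w, s⟩ hv
    funext j
    have hj : w (otherIndex i j) = v j := congrFun hv j
    change f i w (otherIndex i j) = v' j
    have h1 : ∀ v, ext v i (otherIndex i j) = v j := fun v =>
      (otherIndex i).injective.extend_apply _ _ _
    simp only [f, if_neg (otherIndex_ne i j), h1, hj, Equiv.swap_apply_left]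

theorem codedProtocol_isTBSPIR [Fintype F] [Nonempty F] (hK : 0 < K)
    (hα : Function.Injective α) (hN : T + M + 2 * B ≤ N) :
    (codedProtocol K B T hL e α hr).IsTBSPIR T B where
  zeroError := codedProtocol_zeroError hα hN
  userPrivacy := codedProtocol_userPrivacy hK hα
  databasePrivacy := codedProtocol_databasePrivacy hK

theorem codedProtocol_fileEntropy [Fintype F] [Nontrivial F] (hK : 0 < K) (k : Fin K) :
    (codedProtocol K B T hL e α hr).fileEntropy k = M * Real.log (Fintype.card E) := by
  classical
  rw [Protocol.fileEntropy_eq_log _ hK]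
  have : Fintype.card (codedProtocol K B T hL e α hr).File = Fintype.card E ^ M :=
    (Fintype.card_congr e).trans (by simp)
  rw [this]
  simp

theorem codedProtocol_entropy_commonRand [Fintype F] [Nonempty F] (hK : 0 < K) :
    entropy (codedProtocol K B T hL e α hr).law (codedProtocol K B T hL e α hr).commonRand
      = T * Real.log (Fintype.card E) + ∑ g, Real.negMulLog (r g) := by
  classical
  set P := codedProtocol K B T hL e α hr with hP
  have hd : (Fintype.card P.Database : ℝ) ≠ 0 :=
    Nat.cast_ne_zero.2 (Fintype.card_ne_zero (α := P.Database))
  have hprob : ∀ s, prob P.serverLaw (fun x => x.2) s = P.commonProb s := by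
    intro s
    rw [prob_eq_sum_ite, Fintype.sum_prod_type]
    simp only [Finset.sum_ite_eq', Finset.mem_univ, if_true, Protocol.serverLaw, Finset.sum_const,
      Finset.card_univ, nsmul_eq_mul]
    exact mul_inv_cancel_left₀ hd _
  refine (P.entropy_law_server hK (fun x => x.2)).trans ?_
  rw [entropy_eq_sum]
  simp only [hprob, Protocol.serverLaw]
  rw [Fintype.sum_prod_type]
  simp only [mul_assoc, ← Finset.mul_sum]
  rw [Finset.sum_const, Finset.card_univ, nsmul_eq_mul, inv_mul_cancel_left₀ hd]
  change ∑ s : (Fin T → E) × Fin n, (Fintype.card (Fin T → E) : ℝ)⁻¹ * r s.2 *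
    -Real.log ((Fintype.card (Fin T → E) : ℝ)⁻¹ * r s.2) = _
  have hc : (Fintype.card (Fin T → E) : ℝ) ≠ 0 := Nat.cast_ne_zero.2 Fintype.card_ne_zero
  have h : ∀ s : (Fin T → E) × Fin n, (Fintype.card (Fin T → E) : ℝ)⁻¹ * r s.2 *
      -Real.log ((Fintype.card (Fin T → E) : ℝ)⁻¹ * r s.2)
      = (Fintype.card (Fin T → E) : ℝ)⁻¹ *
        (r s.2 * Real.log (Fintype.card (Fin T → E)) + Real.negMulLog (r s.2)) := by
    intro s
    by_cases h0 : r s.2 = 0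
    · simp [h0]
    rw [Real.log_mul (inv_ne_zero hc) h0, Real.log_inv, Real.negMulLog]
    ring
  rw [Finset.sum_congr rfl fun s _ => h s, Fintype.sum_prod_type]
  simp only [← Finset.mul_sum, Finset.sum_add_distrib, ← Finset.sum_mul, hr.2, one_mul]
  rw [Finset.sum_const, Finset.sum_const, Finset.card_univ, nsmul_eq_mul, nsmul_eq_mul, ← mul_add,
    inv_mul_cancel_left₀ hc]
  simp

/-- A lower bound is enough, since the converse gives the matching one; each answer is one symbol of
`E`. -/
theorem le_codedProtocol_rate [Fintype F] [Nontrivial F] (hK : 0 < K) (hN : 0 < N)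
    (k : Fin K) : ENNReal.ofReal (M / N) ≤ (codedProtocol K B T hL e α hr).rate k := by
  classical
  have hE : 0 < Real.log (Fintype.card E) :=
    Real.log_pos (by exact_mod_cast Fintype.one_lt_card)
  have hN' : (0 : ℝ) < N := by exact_mod_cast hN
  have h1 : ∑ m, entropy (codedProtocol K B T hL e α hr).law
      ((codedProtocol K B T hL e α hr).answerVar m k) ≤ N * Real.log (Fintype.card E) := by
    calc _ ≤ ∑ _m : Fin N, Real.log (Fintype.card E) := Finset.sum_le_sum fun m _ =>
          entropy_le_log_card (α := E) (Protocol.law_mem _ hK) _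
      _ = _ := by simp
  unfold Protocol.rate
  rw [codedProtocol_fileEntropy hK]
  refine le_trans ?_ (ENNReal.div_le_div_left (ENNReal.ofReal_le_ofReal h1) _)
  rw [← ENNReal.ofReal_div_of_pos (by positivity), mul_div_mul_right _ _ hE.ne']

end Scheme

/-! ### Choice of the parameters and conclusion. -/

/-- Long enough words over a finite field are words over a large field. -/
theorem exists_field_equiv (F : Type) [Field F] [Fintype F] (N M : ℕ) (hM : 0 < M) :
    ∃ (E : Type) (_ : Field E) (_ : Fintype E) (L : ℕ), 0 < L ∧ N ≤ Fintype.card E ∧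
      Nonempty ((Fin L → F) ≃ (Fin M → E)) := by
  classical
  obtain ⟨p, hp⟩ := CharP.exists F
  obtain ⟨n, hprime, hcard⟩ := FiniteField.card F p
  have : Fact p.Prime := ⟨hprime⟩
  -- The extension has `|F| ^ (N + 1)` elements; the exponent `N + 1` makes this at least `N` and
  -- keeps the degree nonzero even for `N = 0`.
  have hne : (n : ℕ) * (N + 1) ≠ 0 := mul_ne_zero n.ne_zero (by omega)
  have hc := GaloisField.card p ((n : ℕ) * (N + 1)) hne
  have hfin : Finite (GaloisField p ((n : ℕ) * (N + 1))) := inferInstance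
  let _ : Fintype (GaloisField p ((n : ℕ) * (N + 1))) := Fintype.ofFinite _
  rw [Nat.card_eq_fintype_card, pow_mul, ← hcard] at hc
  refine ⟨GaloisField p ((n : ℕ) * (N + 1)), inferInstance, inferInstance, (N + 1) * M,
    by positivity, ?_, ⟨Fintype.equivOfCardEq ?_⟩⟩
  · rw [hc]
    exact (Nat.lt_pow_self Fintype.one_lt_card).le.trans
      (Nat.pow_le_pow_right Fintype.card_pos (Nat.le_succ N))
  · simp only [Fintype.card_fun, Fintype.card_fin]
    rw [hc, pow_mul]

theorem exists_isTBSPIR (F : Type) [Field F] [Fintype F] (K N T B : ℕ) (hK : 2 ≤ K)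
    (hN : 2 * B + T < N) {ρ : ℝ} (hρ : (T : ℝ) / ((N : ℝ) - 2 * B - T) ≤ ρ) (k : Fin K) :
    ∃ P : Protocol F K N, P.IsTBSPIR T B ∧ P.secrecyRate k = ρ ∧
      ENNReal.ofReal (1 - (2 * (B : ℝ) + T) / N) ≤ P.rate k := by
  have hK0 : 0 < K := by omega
  obtain ⟨M, hM⟩ : ∃ M, M + 2 * B + T = N := ⟨N - 2 * B - T, by omega⟩
  have hM' : (M : ℝ) + 2 * B + T = N := by exact_mod_cast hM
  have hM0 : (0 : ℝ) < M := by exact_mod_cast (by omega : 0 < M)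
  have hN0 : (0 : ℝ) < N := by exact_mod_cast (by omega : 0 < N)
  obtain ⟨E, _, _, L, hL, hE, ⟨e⟩⟩ := exists_field_equiv F N M (by omega)
  have hlog : 0 < Real.log (Fintype.card E) :=
    Real.log_pos (by exact_mod_cast Fintype.one_lt_card)
  obtain ⟨α⟩ := Function.Embedding.nonempty_of_card_le (α := Fin N) (β := E) (by simpa using hE)
  rw [show (N : ℝ) - 2 * B - T = M by linarith, div_le_iff₀ hM0] at hρ
  -- The padding has entropy `(ρ M - T) log |E|`, which raises `H(S)` from `T log |E|` to exactly
  -- `ρ` times the file entropy `M log |E|`.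
  obtain ⟨n, r, hr, he⟩ := exists_entropy_eq
    (mul_nonneg (sub_nonneg.2 hρ) hlog.le)
  refine ⟨codedProtocol K B T hL e α hr,
    codedProtocol_isTBSPIR hK0 α.injective (by omega), ?_, ?_⟩
  · unfold Protocol.secrecyRate
    rw [codedProtocol_fileEntropy hK0, codedProtocol_entropy_commonRand hK0, he]
    field_simp
    ring
  · refine le_trans (le_of_eq ?_) (le_codedProtocol_rate hK0 (by omega) k)
    congr 1
    field_simp
    linarith

end SPIR

end

theorem theorem1 (F : Type) [Field F] [Fintype F] (K N T B : ℕ) (hK : 2 ≤ K)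
    (hN : 2 * B + T < N) (ρ : ℝ) (k : Fin K) :
    SPIR.capacity F K N T B ρ k =
      if (T : ℝ) / ((N : ℝ) - 2 * B - T) ≤ ρ then
        ENNReal.ofReal (1 - (2 * (B : ℝ) + T) / N)
      else 0 := by
  unfold SPIR.capacity
  split_ifs with hρ
  · refine le_antisymm (iSup_le fun P => iSup_le fun hP => iSup_le fun _ =>
      P.rate_le hK hN hP k) ?_
    obtain ⟨P, hP, h1, h2⟩ := SPIR.exists_isTBSPIR F K N T B hK hN hρ k
    exact h2.trans (le_iSup_of_le P (le_iSup_of_le hP (le_iSup_of_le h1 le_rfl)))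
  · refine le_antisymm (iSup_le fun P => iSup_le fun hP => iSup_le fun h => ?_) bot_le
    exact absurd (h ▸ P.le_secrecyRate hK hN hP k) hρ
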